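/- Throughout, an $r$-graph $\mathcal H$ is a collection of $r$-element subsets (edges) of a finite vertex set $V(\mathcal H)$, and $v(\mathcal H)=|V(\mathcal H)|$. For $r$-graphs $Q,\mathcal H$, let $\mathrm{inj}(Q,\mathcal H)$ be the number of injective maps $V(Q)\to V(\mathcal H)$ that send edges of $Q$ to edges of $\mathcal H$; $\mathcal H$ is $A$-free if it does not contain the $r$-graph $A$ as a (not necessarily induced) subgraph, and $\mathrm{inj}(n,Q,A)$ is the maximum of $\mathrm{inj}(Q,\mathcal H)$ over all $A$-free $r$-graphs $\mathcal H$ on $n$ vertices. An $r$-graph is $\ell$-partite if its vertices can be coloured with $\ell$ colours so that the vertices of each edge receive distinct colours; $T^r(n,\ell)$ is the balanced complete $\ell$-partite $r$-graph on $n$ vertices, whose edges are all $r$-sets meeting each part in at most one vertex. For an $r$-graph $Q$, the graph $\partial_{r-2}Q$ on $V(Q)$ consists of all pairs contained in an edge of $Q$. For a graph $F$, the expansion $H_F^r$ is the $r$-graph obtained from $F$ by adding to each edge $r-2$ new vertices, the sets of new vertices added to different edges being disjoint. An $r$-graph $A$ is $Q$-edge-stable with respect to $\ell$-partite $r$-graphs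 if for every $\varepsilon>0$ there exist $\delta>0$ and $N_0$ such that every $A$-free $r$-graph $\mathcal H$ on $n\ge N_0$ vertices with $\mathrm{inj}(Q,\mathcal H)\ge(1-\delta)\,\mathrm{inj}(n,Q,A)$ can be made $\ell$-partite by removing at most $\varepsilon n^r$ edges. For $A=K_{\ell+1}$ (with $r=2$) or $A=H_F^r$ with $\chi(F)=\ell+1$, we say that $Q$ is $A$-Turán-stable if for every $\varepsilon>0$ there exist $\delta>0$ and $N_0$ such that every $A$-free $r$-graph $\mathcal H$ on $n\ge N_0$ vertices with $\mathrm{inj}(Q,\mathcal H)\ge(1-\delta)\,\mathrm{inj}(n,Q,A)$ becomes a copy of $T^r(n,\ell)$ after deleting and adding at most $\varepsilon n^r$ edges in total. **Theorem.** Let $\ell\ge r\ge 2$ be integers, let $Q$ be an $r$-graph, and let $F$ be a (finite) graph with $\chi(F)=\ell+1$. (i) If $K_{\ell+1}$ is $\partial_{r-2}Q$-edge-stable with respect to $\ell$-partite graphs, then $H_F^r$ is $Q$-edge-stable with respect to $\ell$-partite $r$-graphs. (ii) If $\partial_{r-2}Q$ is $K_{\ell+1}$-Turán-stable, then $Q$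 is $H_F^r$-Turán-stable. -/

import Mathlib

/-- An `r`-uniform hypergraph (`r`-graph) on the vertex set `V`: a finite collection of
`r`-element subsets of `V`. -/
@[ext]
structure RGraph (V : Type*) (r : ℕ) where
  edges : Finset (Finset V)
  uniform : ∀ e ∈ edges, e.card = r

namespace RGraph

/-- The complete `r`-graph on `V`; `complete (Fin m) r` is `K_m^r`. -/
def complete (V : Type*) [Fintype V] (r : ℕ) : RGraph V r where
  edges := Finset.powersetCard r Finset.univ
  uniform := fun _ he => (Finset.mem_powersetCard.mp he).2

open scoped Classical in
/-- The `i`-graph on `V` of all `i`-sets contained in some edge of `H`. For an `r`-graph `H`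
this is the `(r - i)`-th shadow `∂_{r-i} H`; in particular `H.shadow 2` is `∂_{r-2} H`. -/
noncomputable def shadow {V : Type*} [Fintype V] {r : ℕ} (H : RGraph V r) (i : ℕ) :
    RGraph V i where
  edges := (Finset.powersetCard i Finset.univ).filter fun e => ∃ E ∈ H.edges, e ⊆ E
  uniform := fun _ he => (Finset.mem_powersetCard.mp (Finset.mem_filter.mp he).1).2

open scoped Classical in
/-- The `r`-uniform expansion `H_F^r` of a graph `F`: every edge `e` of `F` is enlarged by
`r - 2` new vertices `(e, i)`, the new vertices of different edges being different. -/
noncomputable def expansion {V : Type*} [Fintype V] (F : SimpleGraph V) (r : ℕ) (hr : 2 ≤ r) :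
    RGraph (V ⊕ (F.edgeSet × Fin (r - 2))) r where
  edges := Finset.univ.image fun e : F.edgeSet =>
    (e : Sym2 V).toFinset.disjSum (({e} : Finset F.edgeSet) ×ˢ (Finset.univ : Finset (Fin (r - 2))))
  uniform := by
    intro E hE
    obtain ⟨e, -, rfl⟩ := Finset.mem_image.mp hE
    rw [Finset.card_disjSum,
      Sym2.card_toFinset_of_not_isDiag _ (F.not_isDiag_of_mem_edgeSet e.2)]
    simp
    omega

open scoped Classical in
/-- The complete multipartite `r`-graph whose parts are the colour classes of `c`: its edges are
the `r`-sets that meet every part in at most one vertex. -/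
noncomputable def completePartite {V C : Type*} [Fintype V] (c : V → C) (r : ℕ) : RGraph V r where
  edges := (Finset.powersetCard r Finset.univ).filter fun e => Set.InjOn c (e : Set V)
  uniform := fun _ he => (Finset.mem_powersetCard.mp (Finset.mem_filter.mp he).1).2

/-- The balanced complete `ℓ`-partite `r`-graph `T^r(n, ℓ)` on `n` vertices; the parts are the
residue classes modulo `ℓ`. -/
noncomputable def turan (r n ℓ : ℕ) : RGraph (Fin n) r :=
  completePartite (fun v : Fin n => (v : ℕ) % ℓ) r

/-- The copy of `H` obtained by relabelling the vertices along a bijection. -/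
def relabel {V W : Type*} {r : ℕ} (H : RGraph V r) (σ : V ≃ W) : RGraph W r where
  edges := H.edges.map (Finset.mapEmbedding σ.toEmbedding).toEmbedding
  uniform := by
    intro e he
    obtain ⟨e', he', rfl⟩ := Finset.mem_map.mp he
    simpa using H.uniform e' he'

open scoped Classical in
/-- `φ` is a homomorphism from `Q` to `H`: it maps edges to edges. -/
def IsHom {U V : Type*} {r : ℕ} (Q : RGraph U r) (H : RGraph V r) (φ : U → V) : Prop :=
  ∀ e ∈ Q.edges, e.image φ ∈ H.edges

/-- `H` is `K_ℓ^r`-colorable, i.e. `ℓ`-partite. -/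
def IsPartite {V : Type*} {r : ℕ} (H : RGraph V r) (ℓ : ℕ) : Prop :=
  ∃ φ : V → Fin ℓ, H.IsHom (complete (Fin ℓ) r) φ

/-- `inj(Q, H)`: the number of injective homomorphisms from `Q` to `H`. -/
noncomputable def inj {U V : Type*} {r : ℕ} (Q : RGraph U r) (H : RGraph V r) : ℕ :=
  Nat.card {φ : U ↪ V // Q.IsHom H φ}

/-- `H` is `A`-free: it does not contain `A` as a (not necessarily induced) subgraph. -/
def Free {U V : Type*} {r : ℕ} (A : RGraph U r) (H : RGraph V r) : Prop :=
  ¬ ∃ φ : U ↪ V, A.IsHom H φ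

/-- `inj(n, Q, A)`: the maximum of `inj(Q, H)` over the `A`-free `r`-graphs `H` on `n` vertices
(see `isGreatest_injMax`). -/
noncomputable def injMax {U W : Type*} {r : ℕ} (n : ℕ) (Q : RGraph U r) (A : RGraph W r) : ℕ :=
  sSup {m | ∃ H : RGraph (Fin n) r, A.Free H ∧ Q.inj H = m}

/-- If `A` has an edge, then `injMax` is attained, so it is a genuine maximum. -/
theorem isGreatest_injMax {U W : Type*} [Finite U] {r : ℕ} (n : ℕ) (Q : RGraph U r)
    (A : RGraph W r) (hA : A.edges.Nonempty) :
    IsGreatest {m | ∃ H : RGraph (Fin n) r, A.Free H ∧ Q.inj H = m} (injMax n Q A) := by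
  have hne : {m | ∃ H : RGraph (Fin n) r, A.Free H ∧ Q.inj H = m}.Nonempty := by
    refine ⟨_, ⟨∅, by simp⟩, ?_, rfl⟩
    rintro ⟨φ, hφ⟩
    obtain ⟨e, he⟩ := hA
    exact absurd (hφ e he) (by simp)
  have hbd : BddAbove {m | ∃ H : RGraph (Fin n) r, A.Free H ∧ Q.inj H = m} := by
    refine ⟨Nat.card (U ↪ Fin n), ?_⟩
    rintro _ ⟨H, -, rfl⟩
    exact Finite.card_subtype_le _
  exact ⟨Nat.sSup_mem hne hbd, fun m hm => le_csSup hbd hm⟩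

open scoped Classical in
/-- `A` is `Q`-edge-stable with respect to the class `𝓗` of `r`-graphs: every `A`-free `r`-graph
on sufficiently many vertices with almost the maximum number of copies of `Q` lies in `𝓗` after
the removal of at most `ε n ^ r` edges. -/
def IsEdgeStable {U W : Type*} {r : ℕ} (A : RGraph W r) (Q : RGraph U r)
    (𝓗 : ∀ n : ℕ, Set (RGraph (Fin n) r)) : Prop :=
  ∀ ε : ℝ, 0 < ε → ∃ δ : ℝ, 0 < δ ∧ ∃ N₀ : ℕ, ∀ n : ℕ, N₀ ≤ n →
    ∀ H : RGraph (Fin n) r, A.Free H → (1 - δ) * (injMax n Q A : ℝ) ≤ (Q.inj H : ℝ) →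
      ∃ H' ∈ 𝓗 n, H'.edges ⊆ H.edges ∧ ((H.edges \ H'.edges).card : ℝ) ≤ ε * (n : ℝ) ^ r

open scoped Classical in
/-- `Q` is `A`-Turán-stable (with `ℓ` parts): every `A`-free `r`-graph on sufficiently many
vertices with almost the maximum number of copies of `Q` becomes a copy of `T^r(n, ℓ)` after
deleting and adding at most `ε n ^ r` edges. -/
def IsTuranStable {U W : Type*} {r : ℕ} (Q : RGraph U r) (A : RGraph W r) (ℓ : ℕ) : Prop :=
  ∀ ε : ℝ, 0 < ε → ∃ δ : ℝ, 0 < δ ∧ ∃ N₀ : ℕ, ∀ n : ℕ, N₀ ≤ n →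
    ∀ H : RGraph (Fin n) r, A.Free H → (1 - δ) * (injMax n Q A : ℝ) ≤ (Q.inj H : ℝ) →
      ∃ σ : Fin n ≃ Fin n,
        ((symmDiff H.edges ((turan r n ℓ).relabel σ).edges).card : ℝ) ≤ ε * (n : ℝ) ^ r

end RGraph

/-! Write $q=v(Q)$ and let $\mathcal H$ be an $H_F^r$-free $r$-graph on $n$ vertices with nearly the
maximum number of copies of $Q$. Call a pair of vertices thick if, for every set of at most $K$
other vertices, some edge contains the pair and avoids the set. With $K=v(F)+e(F)r$, a copy of $F$
among the thick pairs would extend greedily to $H_F^r$ (`exists_isHom_expansion_of_thickGraph`), so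
the thick graph is $F$-free. All but $O(n^{r-1})$ edges are cliques of it. Since $F$ is
$(\ell+1)$-colourable, regularity makes the thick graph $K_{\ell+1}$-free by deleting $o(n^2)$ pairs
(`exists_cliqueFree_le_of_colorable`). Hence, up to $o(n^r)$ edges, $\mathcal H$ consists of
$r$-cliques of a $K_{\ell+1}$-free graph $G$, and copies of $Q$ in $\mathcal H$ are, up to $o(n^q)$,
copies of $\partial_{r-2}Q$ in $G$.

For $G$ to be nearly extremal for $\partial_{r-2}Q$, the two maxima must be compared. By stability,
an extremal $K_{\ell+1}$-free graph is almost $\ell$-partite, and in complete $\ell$-partite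
structures copies of $Q$ and of $\partial_{r-2}Q$ coincide. The complete $\ell$-partite $r$-graph is
$H_F^r$-free because $\chi(F)>\ell$, so the graph maximum exceeds the $r$-graph maximum by at most
$o(n^q)$ (`exists_injMax_shadow_le`). This error is relative as well, because stability forces
$\partial_{r-2}Q$ to be $\ell$-partite and thus the maximum to have order $n^q$
(`isEdgeStable_isPartite_and_exists_le_injMax`).

Stability applied to $G$ now gives (i). For (ii), $G$ is close to $T^2(n,\ell)$, so $\mathcal H$ has
few edges outside the corresponding $T^r(n,\ell)$. It also misses few edges of it: each missing edge
costs order $n^{q-r}$ copies of $Q$ (`exists_mul_card_le_card_isHom_completePartite`). -/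

namespace SimpleGraph

/-! ### Regularity: embedding and removal for graphs. -/

open Finset in
/-- **Embedding lemma**: if the vertex classes `U i` are large and pairwise uniform and dense, then
every graph `F` with a proper colouring by the index set embeds, with colour `i` going to `U i`. -/
theorem exists_injective_hom_of_isUniform {α V ι : Type*} [Fintype V] [DecidableEq α]
    (G : SimpleGraph α) [DecidableRel G.Adj] (F : SimpleGraph V) (χ : F.Coloring ι)
    (U : ι → Finset α) {ε γ d : ℝ} (hε : 0 < ε) (hγ : 0 < γ) (hγ1 : γ ≤ 1) (hd : ε + γ ≤ d)
    (hunif : ∀ i j, i ≠ j → G.IsUniform ε (U i) (U j))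
    (hdens : ∀ i j, i ≠ j → d ≤ (G.edgeDensity (U i) (U j) : ℝ))
    (hU : ∀ i, Fintype.card V * (ε * #(U i)) + Fintype.card V < γ ^ Fintype.card V * #(U i)) :
    ∃ f : V → α, Function.Injective f ∧ ∀ a b, F.Adj a b → G.Adj (f a) (f b) := by
  classical
  -- Greedy embedding: each vertex not yet placed keeps a candidate set, which shrinks by a factor
  -- of at worst `γ` per step.
  suffices key : ∀ S : Finset V, ∃ f : V → α, Set.InjOn f S ∧
      (∀ a ∈ S, ∀ b ∈ S, F.Adj a b → G.Adj (f a) (f b)) ∧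
      ∀ w ∉ S, γ ^ #S * #(U (χ w)) ≤ #{x ∈ U (χ w) | ∀ v ∈ S, F.Adj v w → G.Adj (f v) x} by
    obtain ⟨f, h1, h2, -⟩ := key univ
    exact ⟨f, by simpa [Set.injOn_univ] using h1, fun a b => h2 a (mem_univ _) b (mem_univ _)⟩
  intro S
  induction S using Finset.induction_on with
  | empty =>
    have hf : Nonempty (V → α) := by
      refine ⟨fun v => Nonempty.some ?_⟩
      have : (U (χ v)).Nonempty := by
        rw [nonempty_iff_ne_empty]
        intro h
        have := hU (χ v)
        simp only [h, card_empty, Nat.cast_zero, mul_zero, zero_add] at this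
        exact absurd this (not_lt.2 (Nat.cast_nonneg _))
      exact this.to_type
    obtain ⟨f⟩ := hf
    exact ⟨f, by simp, by simp, by simp⟩
  | insert w S hw ih =>
    obtain ⟨f, h1, h2, h3⟩ := ih
    set C : V → Finset α := fun u => {x ∈ U (χ u) | ∀ v ∈ S, F.Adj v u → G.Adj (f v) x} with hC
    have hCU : ∀ u, C u ⊆ U (χ u) := fun u => filter_subset _ _
    set bad : V → Finset α := fun u => {x ∈ C w | (#{y ∈ C u | G.Adj x y} : ℝ) < γ * #(C u)}
      with hbad
    have hSV : ∀ u ∉ S, γ ^ Fintype.card V * #(U (χ u)) ≤ #(C u) := fun u hu =>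
      (mul_le_mul_of_nonneg_right (pow_le_pow_of_le_one hγ.le hγ1 (card_le_univ S))
        (Nat.cast_nonneg _)).trans (h3 u hu)
    have hV1 : (1 : ℝ) ≤ Fintype.card V := by
      exact_mod_cast Fintype.card_pos_iff.2 ⟨w⟩
    have hCε : ∀ u ∉ S, #(U (χ u)) * ε ≤ #(C u) := by
      intro u hu
      have h4 := hSV u hu
      have h5 := hU (χ u)
      have h6 : ε * #(U (χ u)) ≤ Fintype.card V * (ε * #(U (χ u))) :=
        le_mul_of_one_le_left (by positivity) hV1
      linarith
    -- Otherwise uniformity would apply to `bad u` and `C u` and give density above `d - ε ≥ γ`,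
    -- whereas every bad vertex has fewer than `γ * #(C u)` neighbours in `C u`.
    have hbadcard : ∀ u ∉ S, F.Adj w u → (#(bad u) : ℝ) ≤ ε * #(U (χ w)) := by
      intro u hu hwu
      by_contra! hcon
      have hne : χ w ≠ χ u := χ.valid hwu
      have hb : bad u ⊆ U (χ w) := (filter_subset _ _).trans (hCU w)
      have h4 := hunif _ _ hne hb (hCU u) (by linarith) (hCε u hu)
      have h5 := hdens _ _ hne
      have h6 : γ < (G.edgeDensity (bad u) (C u) : ℝ) := by
        have := (abs_lt.1 h4).1
        linarith
      have h7 : (#(G.interedges (bad u) (C u)) : ℝ) ≤ #(bad u) * (γ * #(C u)) := by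
        have : #(G.interedges (bad u) (C u)) = ∑ x ∈ bad u, #{y ∈ C u | G.Adj x y} := by
          simp only [SimpleGraph.interedges, Rel.interedges, card_filter, sum_product]
        rw [this, Nat.cast_sum, ← nsmul_eq_mul]
        exact sum_le_card_nsmul _ _ _ fun x hx => (mem_filter.1 hx).2.le
      rw [SimpleGraph.edgeDensity_def] at h6
      push_cast at h6
      have hpos : (0 : ℝ) < #(bad u) * #(C u) := by
        by_contra! h
        have h0 : ((#(bad u) : ℝ) * #(C u)) = 0 := le_antisymm h (by positivity)
        rw [h0, div_zero] at h6
        linarith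
      rw [lt_div_iff₀ hpos] at h6
      linarith
    -- The forbidden images of `w`: bad vertices and vertices already used. The hypothesis `hU` says
    -- exactly that candidates outnumber them.
    set B : Finset α := ({u | u ∉ S ∧ F.Adj w u} : Finset V).biUnion bad ∪ S.image f with hB
    have hBC : #B < #(C w) := by
      have e1 : (#B : ℝ) ≤ Fintype.card V * (ε * #(U (χ w))) + Fintype.card V := by
        have e2 : (#(({u | u ∉ S ∧ F.Adj w u} : Finset V).biUnion bad) : ℝ) ≤
            Fintype.card V * (ε * #(U (χ w))) := by
          calc (#(({u | u ∉ S ∧ F.Adj w u} : Finset V).biUnion bad) : ℝ)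
              ≤ ∑ u ∈ ({u | u ∉ S ∧ F.Adj w u} : Finset V), (#(bad u) : ℝ) := by
                exact_mod_cast card_biUnion_le
            _ ≤ #({u | u ∉ S ∧ F.Adj w u} : Finset V) • (ε * #(U (χ w))) := by
                refine sum_le_card_nsmul _ _ _ fun u hu => ?_
                simp only [mem_filter, mem_univ, true_and] at hu
                exact hbadcard u hu.1 hu.2
            _ ≤ _ := by
                rw [nsmul_eq_mul]
                gcongr
                exact card_le_univ _
        have e3 : (#(S.image f) : ℝ) ≤ Fintype.card V := by
          exact_mod_cast card_image_le.trans (card_le_univ S)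
        have e4 : (#B : ℝ) ≤ #(({u | u ∉ S ∧ F.Adj w u} : Finset V).biUnion bad) + #(S.image f) := by
          exact_mod_cast card_union_le _ _
        linarith
      have e5 := hU (χ w)
      have e6 := hSV w hw
      exact_mod_cast (e1.trans_lt e5).trans_le e6
    obtain ⟨x, hxC, hxB⟩ := exists_mem_notMem_of_card_lt_card hBC
    have hxf : ∀ v ∈ S, f v ≠ x := fun v hv h =>
      hxB (mem_union_right _ (mem_image.2 ⟨v, hv, h⟩))
    have hxbad : ∀ u ∉ S, F.Adj w u → γ * #(C u) ≤ (#{y ∈ C u | G.Adj x y} : ℝ) := by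
      intro u hu hwu
      by_contra! h
      refine hxB (mem_union_left _ (mem_biUnion.2 ⟨u, ?_, mem_filter.2 ⟨hxC, h⟩⟩))
      simp [hu, hwu]
    have hfS : ∀ v ∈ S, Function.update f w x v = f v := fun v hv =>
      Function.update_of_ne (fun h : v = w => hw (h ▸ hv)) _ _
    have hxA : ∀ v ∈ S, F.Adj v w → G.Adj (f v) x := (mem_filter.1 hxC).2
    refine ⟨Function.update f w x, ?_, ?_, ?_⟩
    · intro a ha b hb hab
      simp only [coe_insert, Set.mem_insert_iff, mem_coe] at ha hb
      rcases ha with rfl | ha <;> rcases hb with rfl | hb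
      · rfl
      · rw [Function.update_self, hfS b hb] at hab
        exact absurd hab.symm (hxf b hb)
      · rw [Function.update_self, hfS a ha] at hab
        exact absurd hab (hxf a ha)
      · rw [hfS a ha, hfS b hb] at hab
        exact h1 ha hb hab
    · intro a ha b hb hab
      rcases mem_insert.1 ha with rfl | ha' <;> rcases mem_insert.1 hb with rfl | hb'
      · exact absurd hab (F.loopless.irrefl _)
      · rw [Function.update_self, hfS b hb']
        exact (hxA b hb' hab.symm).symm
      · rw [Function.update_self, hfS a ha']
        exact hxA a ha' hab
      · rw [hfS a ha', hfS b hb']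
        exact h2 a ha' b hb' hab
    · intro u hu
      obtain ⟨huw, huS⟩ := not_or.1 (fun h => hu (mem_insert.2 h))
      rw [card_insert_of_notMem hw, pow_succ]
      have h4 := h3 u huS
      by_cases hwu : F.Adj w u
      · have h5 := hxbad u huS hwu
        have h6 : {y ∈ C u | G.Adj x y} ⊆
            {y ∈ U (χ u) | ∀ v ∈ insert w S, F.Adj v u → G.Adj (Function.update f w x v) y} := by
          intro y hy
          simp only [hC, mem_filter, forall_mem_insert, Function.update_self] at hy ⊢
          exact ⟨hy.1.1, fun _ => hy.2, fun v hv => by rw [hfS v hv]; exact hy.1.2 v hv⟩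
        calc γ ^ #S * γ * #(U (χ u)) = γ * (γ ^ #S * #(U (χ u))) := by ring
          _ ≤ γ * #(C u) := by gcongr
          _ ≤ _ := h5
          _ ≤ _ := by exact_mod_cast card_le_card h6
      · have h6 : C u ⊆
            {y ∈ U (χ u) | ∀ v ∈ insert w S, F.Adj v u → G.Adj (Function.update f w x v) y} := by
          intro y hy
          simp only [hC, mem_filter, forall_mem_insert, Function.update_self] at hy ⊢
          exact ⟨hy.1, fun h => absurd h hwu, fun v hv => by rw [hfS v hv]; exact hy.2 v hv⟩
        calc γ ^ #S * γ * #(U (χ u)) ≤ γ ^ #S * 1 * #(U (χ u)) := by gcongr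
          _ = γ ^ #S * #(U (χ u)) := by ring
          _ ≤ _ := h4
          _ ≤ _ := by exact_mod_cast card_le_card h6

open Finset SzemerediRegularity in
/-- A large `F`-free graph can be made `K_k`-free by removing few edges, if `F` is
`k`-colourable. -/
theorem exists_cliqueFree_le_of_colorable {V : Type*} [Fintype V] (F : SimpleGraph V) {k : ℕ}
    (hF : F.Colorable k) {ε : ℝ} (hε : 0 < ε) :
    ∃ N : ℕ, ∀ n : ℕ, N ≤ n → ∀ G : SimpleGraph (Fin n),
      (¬ ∃ f : V → Fin n, Function.Injective f ∧ ∀ a b, F.Adj a b → G.Adj (f a) (f b)) →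
      ∃ G' ≤ G, G'.CliqueFree k ∧
        (Nat.card {p : Fin n × Fin n // G.Adj p.1 p.2 ∧ ¬ G'.Adj p.1 p.2} : ℝ) ≤
          ε * (n : ℝ) ^ 2 := by
  classical
  wlog hε1 : ε ≤ 1 generalizing ε
  · obtain ⟨N, hN⟩ := this one_pos le_rfl
    refine ⟨N, fun n hn G hG => ?_⟩
    obtain ⟨G', h1, h2, h3⟩ := hN n hn G hG
    refine ⟨G', h1, h2, h3.trans ?_⟩
    gcongr
    exact (not_le.1 hε1).le
  obtain ⟨χ⟩ := hF
  set v := Fintype.card V with hv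
  -- The bounds `γ = δ / 8` and `η ≤ δ / 8` fit under the density threshold `δ / 4`. The other bound
  -- on `η` makes bad vertices use at most half of the `γ ^ v` fraction of a part, and `N` makes the
  -- parts large enough for the other half to exceed `v`. The deleted pairs amount to `4 * η + δ / 2
  -- + δ ≤ 2 * δ = ε`.
  set δ := ε / 2 with hδ
  have hδ0 : 0 < δ := by positivity
  set γ := δ / 8 with hγ
  have hγ0 : 0 < γ := by positivity
  have hγ1 : γ ≤ 1 := by rw [hγ, hδ]; linarith
  set η := min (δ / 8) (γ ^ v / (2 * (v + 1))) with hη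
  have hη0 : 0 < η := by positivity
  set l : ℕ := ⌈4 / δ⌉₊ with hl
  set M := bound η l with hM
  have hM0 : 0 < M := bound_pos _ _
  set N : ℕ := max l ⌈(2 * M) * (2 * v / γ ^ v + 1)⌉₊ + 1 with hN
  refine ⟨N, fun n hn G hG => ?_⟩
  have hln : l ≤ n := (le_max_left _ _).trans ((Nat.le_succ _).trans hn)
  have hMn : (2 * M) * (2 * v / γ ^ v + 1) ≤ (n : ℝ) :=
    (Nat.le_ceil _).trans (by exact_mod_cast (le_max_right _ _).trans ((Nat.le_succ _).trans hn))
  have hn0 : 0 < n := (Nat.succ_pos _).trans_le hn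
  have : Nonempty (Fin n) := ⟨⟨0, hn0⟩⟩
  obtain ⟨P, hP₁, hP₂, hP₃, hP₄⟩ := szemeredi_regularity G hη0
    (show l ≤ Fintype.card (Fin n) by simpa using hln)
  have hP' : 4 / δ ≤ #P.parts := (Nat.le_ceil _).trans (Nat.cast_le.2 hP₂)
  have hcard : ∀ s ∈ P.parts, 2 * v / γ ^ v + 1 ≤ (#s : ℝ) := by
    intro s hs
    have hpos : 0 < #P.parts := card_pos.2 ⟨s, hs⟩
    have h1 : n / #P.parts ≤ #s := by
      have := hP₁.average_le_card_part hs
      simpa using this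
    have h2 : #P.parts ≤ n := by simpa using P.card_parts_le_card
    have h3 : n < 2 * #P.parts * (n / #P.parts) := by
      have h4 := Nat.div_add_mod n #P.parts
      have h5 := Nat.mod_lt n hpos
      have h6 : #P.parts * 1 ≤ #P.parts * (n / #P.parts) :=
        Nat.mul_le_mul_left _ ((Nat.one_le_div_iff hpos).2 h2)
      nlinarith
    have h4 : (n : ℝ) ≤ 2 * M * #s := by
      have : n ≤ 2 * M * #s := h3.le.trans (by gcongr)
      exact_mod_cast this
    have h5 : (0 : ℝ) < 2 * M := by positivity
    exact le_of_mul_le_mul_left (hMn.trans h4) h5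
  refine ⟨G.regularityReduced P η (δ / 4), regularityReduced_le, ?_, ?_⟩
  · by_contra hK
    rw [not_cliqueFree_iff_top_isContained] at hK
    obtain ⟨φ⟩ := hK
    have hadj : ∀ i j : Fin k, i ≠ j → (G.regularityReduced P η (δ / 4)).Adj (φ i) (φ j) :=
      fun i j hij => φ.toHom.map_adj (by simpa using hij)
    choose U hU hφU using fun i : Fin k => P.exists_mem (mem_univ (φ i))
    have hpart : ∀ (i : Fin k) (s), s ∈ P.parts → φ i ∈ s → U i = s := fun i s hs his =>
      P.disjoint.elim (hU i) hs (not_disjoint_iff.2 ⟨φ i, hφU i, his⟩)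
    have hij : ∀ i j, i ≠ j → G.IsUniform η (U i) (U j) ∧
        δ / 4 ≤ (G.edgeDensity (U i) (U j) : ℝ) := by
      intro i j hne
      obtain ⟨-, s, hs, t, ht, his, hjt, -, hu, hd⟩ := hadj i j hne
      rw [hpart i s hs his, hpart j t ht hjt]
      exact ⟨hu, hd⟩
    refine hG (exists_injective_hom_of_isUniform G F χ U hη0 hγ0 hγ1 (d := δ / 4) ?_
      (fun i j h => (hij i j h).1) (fun i j h => (hij i j h).2) ?_)
    · have := min_le_left (δ / 8) (γ ^ v / (2 * (v + 1)))
      rw [← hη] at this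
      rw [hγ]
      linarith
    · intro i
      have h1 := hcard _ (hU i)
      set u : ℝ := (#(U i) : ℝ)
      have h2 : η ≤ γ ^ v / (2 * (v + 1)) := min_le_right _ _
      have hv0 : (0 : ℝ) < 2 * (v + 1) := by positivity
      rw [le_div_iff₀ hv0] at h2
      have hg : (0 : ℝ) < γ ^ v := by positivity
      have h3 : 2 * v < γ ^ v * u := by
        have : 2 * v / γ ^ v < u := by linarith
        rw [div_lt_iff₀ hg] at this
        linarith
      have hu0 : 0 ≤ u := Nat.cast_nonneg _
      have h4 : v * (η * u) * 2 ≤ γ ^ v * u := by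
        have : η * (2 * (v + 1)) * u ≤ γ ^ v * u := by gcongr
        nlinarith [mul_nonneg hη0.le hu0]
      linarith
  -- Deleted pairs lie between non-uniform parts, inside one part, or between sparse parts.
  · set A := (P.nonUniforms G η).biUnion fun (U, V) ↦ U ×ˢ V
    set B := P.parts.biUnion offDiag
    set C := (P.sparsePairs G (δ / 4)).biUnion fun (U, V) ↦ G.interedges U V
    rw [Nat.card_eq_fintype_card, Fintype.card_subtype]
    have hsub : ({p : Fin n × Fin n | G.Adj p.1 p.2 ∧
        ¬ (G.regularityReduced P η (δ / 4)).Adj p.1 p.2} : Finset _) ⊆ A ∪ B ∪ C := by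
      rintro ⟨x, y⟩ hxy
      obtain ⟨h, h'⟩ := (mem_filter.1 hxy).2
      obtain ⟨U, hU, hx⟩ := P.exists_mem (mem_univ x)
      obtain ⟨W, hW, hy⟩ := P.exists_mem (mem_univ y)
      simp only [A, B, C, mem_union, mem_biUnion, Prod.exists, Finpartition.mk_mem_nonUniforms,
        Finpartition.mk_mem_sparsePairs, mem_product, mem_offDiag, mem_interedges_iff]
      by_cases hUW : U = W
      · subst hUW
        exact Or.inl (Or.inr ⟨U, hU, hx, hy, G.ne_of_adj h⟩)
      by_cases h₂ : G.IsUniform η U W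
      · refine Or.inr ⟨U, W, ⟨hU, hW, hUW, ?_⟩, hx, hy, h⟩
        by_contra! h3
        exact h' ⟨h, U, hU, W, hW, hx, hy, hUW, h₂, h3⟩
      · exact Or.inl (Or.inl ⟨U, W, ⟨hU, hW, hUW, h₂⟩, hx, hy⟩)
    have hA : (#A : ℝ) ≤ 4 * η * (n : ℝ) ^ 2 := by
      have := (hP₁.sum_nonUniforms_lt univ_nonempty hη0 hP₄).le
      simpa using this
    have hB : (#B : ℝ) ≤ δ / 2 * (n : ℝ) ^ 2 := by
      have := hP₁.card_biUnion_offDiag_le hδ0 hP'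
      simpa using this
    have hC : (#C : ℝ) ≤ 4 * (δ / 4) * (n : ℝ) ^ 2 := by
      have := hP₁.card_interedges_sparsePairs_le (G := G) (ε := δ / 4) (by positivity)
      simpa using this
    have hABC : (#({p : Fin n × Fin n | G.Adj p.1 p.2 ∧
        ¬ (G.regularityReduced P η (δ / 4)).Adj p.1 p.2} : Finset _) : ℝ) ≤ #A + #B + #C := by
      have := (card_le_card hsub).trans ((card_union_le _ _).trans
        (Nat.add_le_add_right (card_union_le _ _) _))
      exact_mod_cast this
    have hηδ : η ≤ δ / 8 := min_le_left _ _
    have h1 : 4 * η * (n : ℝ) ^ 2 ≤ 4 * (δ / 8) * (n : ℝ) ^ 2 := by gcongr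
    have h2 : δ = ε / 2 := hδ
    nlinarith

end SimpleGraph

/-! ### Counting edges and injections. -/

namespace RGraph

section Counting

variable {U V : Type*} [Fintype U] [Fintype V]

open Finset in
open scoped Classical in
/-- The number of `r`-sets containing a member of a family `R` of `s`-sets. -/
theorem card_powersetCard_superset_mul_le (R : Finset (Finset V)) {s : ℕ} (r : ℕ)
    (hR : ∀ t ∈ R, #t = s) :
    #{e ∈ powersetCard r (univ : Finset V) | ∃ t ∈ R, t ⊆ e} * Fintype.card V ^ s ≤
      #R * Fintype.card V ^ r := by
  rcases le_or_gt s r with hsr | hsr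
  · have hsub : {e ∈ powersetCard r (univ : Finset V) | ∃ t ∈ R, t ⊆ e} ⊆
        (R ×ˢ powersetCard (r - s) univ).image fun p => p.1 ∪ p.2 := by
      intro e he
      obtain ⟨he, t, ht, hte⟩ := mem_filter.1 he
      refine mem_image.2 ⟨(t, e \ t), mem_product.2 ⟨ht, ?_⟩, union_sdiff_of_subset hte⟩
      rw [mem_powersetCard, card_sdiff_of_subset hte, hR t ht, (mem_powersetCard.1 he).2]
      exact ⟨subset_univ _, rfl⟩
    calc _ ≤ #R * Fintype.card V ^ (r - s) * Fintype.card V ^ s := by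
          gcongr
          refine (card_le_card hsub).trans (card_image_le.trans ?_)
          rw [card_product, card_powersetCard]
          gcongr
          exact Nat.choose_le_pow _ _
      _ = _ := by rw [mul_assoc, ← pow_add, Nat.sub_add_cancel hsr]
  · have : ({e ∈ powersetCard r (univ : Finset V) | ∃ t ∈ R, t ⊆ e} : Finset _) = ∅ := by
      rw [filter_eq_empty_iff]
      rintro e he ⟨t, ht, hte⟩
      have := card_le_card hte
      rw [hR t ht, (mem_powersetCard.1 he).2] at this
      omega
    rw [this]
    simp

open Finset in
open scoped Classical in
/-- The number of injections mapping the set `E` onto a member of a given family. -/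
theorem card_embedding_image_mem_mul_le (E : Finset U) (R : Finset (Finset V))
    (hR : ∀ e ∈ R, #e = #E) :
    #{φ : U ↪ V | E.map φ ∈ R} * Fintype.card V ^ #E ≤
      #R * #E ^ #E * Fintype.card V ^ Fintype.card U := by
  -- Encode `φ` by the edge hit, its restriction to `E` and its values off `E`.
  let f : {φ : U ↪ V // E.map φ ∈ R} → (Σ e : R, E → (e : Finset V)) × ({u // u ∉ E} → V) :=
    fun φ => (⟨⟨_, φ.2⟩, fun u => ⟨φ.1 u, mem_map_of_mem _ u.2⟩⟩, fun u => φ.1 u)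
  have hf : Function.Injective f := by
    intro φ ψ h
    obtain ⟨h1, h2⟩ := Prod.mk.inj h
    ext u
    by_cases hu : u ∈ E
    · have h3 : ∀ p q : (Σ e : R, E → (e : Finset V)), p = q →
          ((p.2 ⟨u, hu⟩ : (p.1 : Finset V)) : V) = (q.2 ⟨u, hu⟩ : (q.1 : Finset V)) := by
        rintro p _ rfl
        rfl
      exact h3 _ _ h1
    · exact congrFun h2 ⟨u, hu⟩
  have hc := Fintype.card_le_of_injective f hf
  rw [Fintype.card_subtype, Fintype.card_prod, Fintype.card_sigma] at hc
  have h1 : ∑ e : R, Fintype.card (E → (e : Finset V)) = #R * #E ^ #E := by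
    have : ∀ e : R, Fintype.card (E → (e : Finset V)) = #E ^ #E := fun e => by
      simp [hR e.1 e.2]
    simp [this]
  have h2 : Fintype.card ({u // u ∉ E} → V) = Fintype.card V ^ (Fintype.card U - #E) := by
    rw [Fintype.card_fun, Fintype.card_subtype_compl, Fintype.card_coe]
  rw [h1, h2] at hc
  calc _ ≤ #R * #E ^ #E * Fintype.card V ^ (Fintype.card U - #E) * Fintype.card V ^ #E := by
        gcongr
    _ = _ := by rw [mul_assoc _ (_ ^ _) (_ ^ _), ← pow_add, Nat.sub_add_cancel (card_le_univ E)]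

open Finset in
open scoped Classical in
theorem inj_eq_card {r : ℕ} (Q : RGraph U r) (H : RGraph V r) :
    Q.inj H = #{φ : U ↪ V | Q.IsHom H φ} := by
  rw [inj, Nat.card_eq_fintype_card, Fintype.card_subtype]

omit [Fintype U] [Fintype V] in
theorem isHom_iff_map {r : ℕ} {Q : RGraph U r} {H : RGraph V r} {φ : U ↪ V} :
    Q.IsHom H φ ↔ ∀ E ∈ Q.edges, E.map φ ∈ H.edges := by
  classical
  refine forall₂_congr fun E _ => ?_
  rw [Finset.map_eq_image]

open Finset in
open scoped Classical in
/-- If every copy of `P` in `H` using no edge of a small set `R` is a copy of `P'` in `H'`, then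
`H` has at most few more copies of `P` than `H'` has of `P'`. -/
theorem inj_le_inj_add {r s : ℕ} (P : RGraph U r) (H : RGraph V r) (P' : RGraph U s)
    (H' : RGraph V s) (R : Finset (Finset V)) (hR : ∀ e ∈ R, #e = r)
    (h : ∀ φ : U ↪ V, P.IsHom H φ → (∀ E ∈ P.edges, E.map φ ∉ R) → P'.IsHom H' φ)
    {ε : ℝ} (hV : 0 < Fintype.card V) (hRε : (#R : ℝ) ≤ ε * (Fintype.card V : ℝ) ^ r) :
    (P.inj H : ℝ) ≤ P'.inj H' + #P.edges * r ^ r * ε * (Fintype.card V : ℝ) ^ Fintype.card U := by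
  set n := Fintype.card V
  -- A copy of `P` in `H` that is not a copy of `P'` in `H'` maps some edge of `P` into `R`; a union
  -- bound over the edges of `P` follows.
  have hsub : ({φ : U ↪ V | P.IsHom H φ} : Finset _) ⊆
      ({φ : U ↪ V | P'.IsHom H' φ} : Finset _) ∪
      P.edges.biUnion fun E => {φ : U ↪ V | E.map φ ∈ R} := by
    intro φ hφ
    rw [mem_filter] at hφ
    by_cases h1 : ∀ E ∈ P.edges, E.map φ ∉ R
    · exact mem_union_left _ (mem_filter.2 ⟨mem_univ _, h φ hφ.2 h1⟩)
    · push Not at h1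
      obtain ⟨E, hE, hER⟩ := h1
      exact mem_union_right _ (mem_biUnion.2 ⟨E, hE, mem_filter.2 ⟨mem_univ _, hER⟩⟩)
  have hn : (0 : ℝ) < (n : ℝ) ^ r := by positivity
  have hE : ∀ E ∈ P.edges, (#{φ : U ↪ V | E.map φ ∈ R} : ℝ) ≤
      r ^ r * ε * (n : ℝ) ^ Fintype.card U := by
    intro E hE
    have h1 := card_embedding_image_mem_mul_le E R (fun e he => by rw [hR e he, P.uniform E hE])
    rw [P.uniform E hE] at h1
    have h2 : (#{φ : U ↪ V | E.map φ ∈ R} : ℝ) * (n : ℝ) ^ r ≤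
        #R * r ^ r * (n : ℝ) ^ Fintype.card U := by exact_mod_cast h1
    refine le_of_mul_le_mul_right (h2.trans ?_) hn
    calc (#R : ℝ) * r ^ r * (n : ℝ) ^ Fintype.card U
        ≤ (ε * (n : ℝ) ^ r) * r ^ r * (n : ℝ) ^ Fintype.card U := by gcongr
      _ = _ := by ring
  have hcard := (card_le_card hsub).trans ((card_union_le _ _).trans
    (Nat.add_le_add_left card_biUnion_le _))
  rw [inj_eq_card, inj_eq_card]
  calc (#{φ : U ↪ V | P.IsHom H φ} : ℝ)
      ≤ #{φ : U ↪ V | P'.IsHom H' φ} + ∑ E ∈ P.edges, (#{φ : U ↪ V | E.map φ ∈ R} : ℝ) := by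
        exact_mod_cast hcard
    _ ≤ #{φ : U ↪ V | P'.IsHom H' φ} + #P.edges • (r ^ r * ε * (n : ℝ) ^ Fintype.card U) := by
        gcongr
        exact sum_le_card_nsmul _ _ _ hE
    _ = _ := by rw [nsmul_eq_mul]; ring

open Finset in
/-- Choosing the images from pairwise disjoint sets gives injections. -/
theorem prod_card_le_card_embedding (S : U → Finset V)
    (hS : ∀ u w, u ≠ w → Disjoint (S u) (S w)) :
    ∏ u, #(S u) ≤ Nat.card {φ : U ↪ V // ∀ u, φ u ∈ S u} := by
  classical
  rw [← Fintype.card_piFinset, ← Fintype.card_coe, ← Nat.card_eq_fintype_card]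
  refine Nat.card_le_card_of_injective
    (fun f => ⟨⟨f.1, fun u w h => ?_⟩, Fintype.mem_piFinset.1 f.2⟩) ?_
  · by_contra huw
    exact disjoint_left.1 (hS u w huw) (Fintype.mem_piFinset.1 f.2 u)
      (h ▸ Fintype.mem_piFinset.1 f.2 w)
  · intro f g h
    exact Subtype.ext (congrArg (fun φ => (φ.1 : U → V)) h)

end Counting

/-- The vertices of one residue class. -/
theorem div_le_card_filter_mod {n K j : ℕ} (hj : j < K) (σ : Fin n ≃ Fin n) :
    n / K ≤ (Finset.univ.filter fun v : Fin n => (σ.symm v : ℕ) % K = j).card := by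
  have hlt : ∀ t : Fin (n / K), K * t + j < n := fun t => by
    have h1 : K * (t + 1) ≤ K * (n / K) := Nat.mul_le_mul_left _ t.2
    have h2 := Nat.mul_div_le n K
    rw [mul_add] at h1
    omega
  calc n / K = (Finset.univ : Finset (Fin (n / K))).card := by simp
    _ ≤ _ := by
      refine Finset.card_le_card_of_injOn (fun t => σ ⟨K * t + j, hlt t⟩) ?_ ?_
      · intro t _
        simp [Nat.mod_eq_of_lt hj]
      · intro s _ t _ h
        have h := Fin.mk.inj_iff.1 (σ.injective h)
        have hK : 0 < K := (Nat.zero_le _).trans_lt hj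
        exact Fin.ext (Nat.eq_of_mul_eq_mul_left hK (by omega))

/-- The colouring of `Fin n` by the residues modulo `k`, transported along `σ`. -/
def residue {n : ℕ} (k : ℕ) [NeZero k] (σ : Fin n ≃ Fin n) (v : Fin n) : Fin k :=
  Fin.ofNat k (σ.symm v)

open Finset in
/-- The number of injections with prescribed residues and with prescribed values on `E`. -/
theorem pow_le_card_embedding_residue {U : Type*} [Fintype U] (k : ℕ) [NeZero k] {n : ℕ}
    (σ : Fin n ≃ Fin n) (ψ : U → Fin k) (E : Finset U) (β : U → Fin n) (hβ : Set.InjOn β E)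
    (hβψ : ∀ u ∈ E, residue k σ (β u) = ψ u) :
    (n / (k * (Fintype.card U + 1)) - #E) ^ (Fintype.card U - #E) ≤
      Nat.card {φ : U ↪ Fin n // (∀ u, residue k σ (φ u) = ψ u) ∧ ∀ u ∈ E, φ u = β u} := by
  classical
  set q := Fintype.card U
  set K := k * (q + 1)
  have hk : 0 < k := NeZero.pos k
  let ι := Fintype.equivFin U
  -- Refining residues modulo `k` to residues modulo `k * (q + 1)` gives each `u` a class of its own
  -- inside the prescribed one, which makes injectivity automatic. Using `q + 1` keeps the modulus
  -- positive when `U` is empty.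
  let j : U → ℕ := fun u => ψ u + k * ι u
  have hj : ∀ u, j u < K := fun u => by
    have h1 := (ψ u).2
    have h2 : k * (ι u + 1) ≤ k * (q + 1) := Nat.mul_le_mul_left _ (by have := (ι u).2; omega)
    simp only [j, K]
    rw [mul_add] at h2
    omega
  have hjinj : Function.Injective j := by
    intro u w h
    have h1 : j u / k = j w / k := by rw [h]
    simp only [j, Nat.add_mul_div_left _ _ hk, Nat.div_eq_of_lt (ψ _).2, zero_add] at h1
    exact ι.injective (Fin.ext h1)
  let S : U → Finset (Fin n) := fun u =>
    if u ∈ E then {β u} else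
    (univ.filter fun v : Fin n => (σ.symm v : ℕ) % K = j u) \ E.image β
  have hdisj : ∀ u w, u ≠ w → Disjoint (S u) (S w) := by
    intro u w huw
    simp only [S]
    split_ifs with hu hw hw
    · exact disjoint_singleton.2 fun h => huw (hβ hu hw h)
    · exact disjoint_singleton_left.2 fun h =>
        (mem_sdiff.1 h).2 (mem_image_of_mem _ hu)
    · exact disjoint_singleton_right.2 fun h =>
        (mem_sdiff.1 h).2 (mem_image_of_mem _ hw)
    · rw [disjoint_left]
      intro v hv hv'
      have h1 := (mem_filter.1 (mem_sdiff.1 hv).1).2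
      have h2 := (mem_filter.1 (mem_sdiff.1 hv').1).2
      exact huw (hjinj (h1.symm.trans h2))
  calc (n / K - #E) ^ (q - #E) ≤ ∏ u, #(S u) := by
        calc (n / K - #E) ^ (q - #E) = ∏ u ∈ Eᶜ, (n / K - #E) := by
              rw [prod_const, card_compl]
          _ ≤ ∏ u ∈ Eᶜ, #(S u) := by
              refine prod_le_prod' fun u hu => ?_
              simp only [S, if_neg (mem_compl.1 hu)]
              calc n / K - #E ≤ #{v : Fin n | (σ.symm v : ℕ) % K = j u} - #(E.image β) :=
                    tsub_le_tsub (div_le_card_filter_mod (hj u) σ) card_image_le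
                _ ≤ _ := le_card_sdiff _ _
          _ = ∏ u, #(S u) := by
              rw [← prod_mul_prod_compl E]
              have : ∏ u ∈ E, #(S u) = 1 := prod_eq_one fun u hu => by simp [S, hu]
              rw [this, one_mul]
    _ ≤ Nat.card {φ : U ↪ Fin n // ∀ u, φ u ∈ S u} := prod_card_le_card_embedding S hdisj
    _ ≤ _ := by
        refine Nat.card_mono (Set.toFinite _) fun φ hφ => ⟨fun u => ?_, fun u hu => ?_⟩
        · have h1 := hφ u
          simp only [S] at h1
          split_ifs at h1 with hu
          · rw [mem_singleton.1 h1, hβψ u hu]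
          · have h2 := (mem_filter.1 (mem_sdiff.1 h1).1).2
            ext
            rw [residue, Fin.val_ofNat, ← Nat.mod_mul_right_mod _ k (q + 1), h2]
            simp [j, Nat.mod_eq_of_lt (ψ u).2]
        · have h1 := hφ u
          simp only [S, if_pos hu, mem_singleton] at h1
          exact h1

open Finset in
/-- The number of injections with prescribed residues and with `s` prescribed values has order
`n ^ (q - s)`. -/
theorem exists_le_card_embedding_residue (U : Type*) [Fintype U] (k : ℕ) [NeZero k] (s : ℕ) :
    ∃ κ : ℝ, 0 < κ ∧ ∃ N : ℕ, ∀ n, N ≤ n → ∀ (σ : Fin n ≃ Fin n) (ψ : U → Fin k) (E : Finset U)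
      (β : U → Fin n), #E = s → Set.InjOn β E → (∀ u ∈ E, residue k σ (β u) = ψ u) →
      κ * (n : ℝ) ^ (Fintype.card U - s) ≤
        Nat.card {φ : U ↪ Fin n // (∀ u, residue k σ (φ u) = ψ u) ∧ ∀ u ∈ E, φ u = β u} := by
  set q := Fintype.card U
  set K := k * (q + 1)
  have hK : 0 < K := Nat.mul_pos (NeZero.pos k) (Nat.succ_pos _)
  -- The threshold ensures `n / K - s ≥ n / (2 * K)` despite the rounding in `n / K`.
  refine ⟨(1 / (2 * K)) ^ (q - s), by positivity, 2 * K * (s + 1), ?_⟩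
  intro n hn σ ψ E β hE hβ hβψ
  have h1 := pow_le_card_embedding_residue k σ ψ E β hβ hβψ
  rw [hE] at h1
  refine le_trans ?_ (Nat.cast_le.2 h1)
  rw [← mul_pow, Nat.cast_pow]
  gcongr
  have h2 : n ≤ 2 * K * (n / K - s) := by
    have h3 : 2 * (s + 1) ≤ n / K := by
      rw [Nat.le_div_iff_mul_le hK]
      linarith
    have h4 := Nat.div_add_mod n K
    have h5 := Nat.mod_lt n hK
    obtain ⟨d, hd⟩ := Nat.exists_eq_add_of_le h3
    rw [hd] at h4 ⊢
    have h6 : 2 * (s + 1) + d - s = s + 2 + d := by omega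
    rw [h6]
    nlinarith
  have h3 : (n : ℝ) ≤ 2 * K * ((n / K - s : ℕ) : ℝ) := by exact_mod_cast h2
  rw [one_div, inv_mul_le_iff₀ (by positivity)]
  exact h3

end RGraph

/-! ### Complete partite hypergraphs and blow-ups. -/

namespace RGraph

section Partite

variable {U V W C : Type*} [Fintype U] [Fintype V] {r : ℕ}

theorem mem_edges_complete {e : Finset V} : e ∈ (complete V r).edges ↔ e.card = r := by
  simp [complete]

theorem mem_edges_completePartite {c : V → C} {e : Finset V} :
    e ∈ (completePartite c r).edges ↔ e.card = r ∧ Set.InjOn c e := by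
  simp [completePartite]

theorem mem_edges_shadow {H : RGraph V r} {i : ℕ} {e : Finset V} :
    e ∈ (H.shadow i).edges ↔ e.card = i ∧ ∃ E ∈ H.edges, e ⊆ E := by
  simp [shadow]

omit [Fintype U] [Fintype V] in
theorem isHom_iff [DecidableEq V] {Q : RGraph U r} {H : RGraph V r} {φ : U → V} :
    Q.IsHom H φ ↔ ∀ E ∈ Q.edges, E.image φ ∈ H.edges := by
  unfold IsHom
  congr!

omit [Fintype V] in
theorem isPartite_iff {H : RGraph V r} {ℓ : ℕ} :
    H.IsPartite ℓ ↔ ∃ c : V → Fin ℓ, ∀ e ∈ H.edges, Set.InjOn c e := by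
  refine exists_congr fun c => isHom_iff.trans (forall₂_congr fun e he => ?_)
  rw [mem_edges_complete, ← H.uniform e he, Finset.card_image_iff]

omit [Fintype U] in
theorem isHom_completePartite_iff {Q : RGraph U r} {c : V → C} {φ : U ↪ V} :
    Q.IsHom (completePartite c r) φ ↔ ∀ E ∈ Q.edges, Set.InjOn (c ∘ φ) E := by
  classical
  refine isHom_iff.trans (forall₂_congr fun E hE => ?_)
  rw [mem_edges_completePartite, Finset.card_image_of_injective _ φ.injective, Finset.coe_image]
  refine ⟨fun h => h.2.comp φ.injective.injOn (Set.mapsTo_image _ _), fun h => ⟨Q.uniform E hE, ?_⟩⟩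
  rintro _ ⟨x, hx, rfl⟩ _ ⟨y, hy, rfl⟩ hxy
  rw [h hx hy hxy]

omit [Fintype U] in
theorem injOn_of_forall_pair {f : U → C} {E : Finset U}
    (h : ∀ p : Finset U, p.card = 2 → p ⊆ E → Set.InjOn f p) : Set.InjOn f E := by
  classical
  intro x hx y hy hxy
  by_contra hne
  refine hne (h {x, y} (Finset.card_pair hne) ?_ (by simp) (by simp) hxy)
  simp only [Finset.insert_subset_iff, Finset.singleton_subset_iff]
  exact ⟨hx, hy⟩

theorem injOn_edges_shadow_iff {Q : RGraph U r} {f : U → C} :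
    (∀ p ∈ (Q.shadow 2).edges, Set.InjOn f p) ↔ ∀ E ∈ Q.edges, Set.InjOn f E := by
  refine ⟨fun h E hE => injOn_of_forall_pair fun p hp hpE =>
    h p (mem_edges_shadow.2 ⟨hp, E, hE, hpE⟩), fun h p hp => ?_⟩
  obtain ⟨-, E, hE, hpE⟩ := mem_edges_shadow.1 hp
  exact (h E hE).mono (Finset.coe_subset.2 hpE)

/-- A colouring is injective on an edge as soon as it is injective on its pairs. This is the bridge
that turns copies of the shadow back into copies of `Q`. -/
theorem isHom_shadow_completePartite_iff {Q : RGraph U r} {c : V → C} {φ : U ↪ V} :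
    (Q.shadow 2).IsHom (completePartite c 2) φ ↔ Q.IsHom (completePartite c r) φ := by
  rw [isHom_completePartite_iff, isHom_completePartite_iff, injOn_edges_shadow_iff]

omit [Fintype V] in
theorem isHom_complete_two_iff {m : ℕ} {H : RGraph V 2} {φ : Fin m ↪ V} :
    (complete (Fin m) 2).IsHom H φ ↔
      ∀ i j, i ≠ j → ({φ i, φ j} : Set V) ∈ (fun e : Finset V => (e : Set V)) '' H.edges := by
  classical
  rw [isHom_iff]
  constructor
  · intro h i j hij
    refine ⟨_, h {i, j} (mem_edges_complete.2 (Finset.card_pair hij)), ?_⟩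
    simp
  · intro h e he
    obtain ⟨i, j, hij, rfl⟩ := Finset.card_eq_two.1 (mem_edges_complete.1 he)
    obtain ⟨e, he, h1⟩ := h i j hij
    have h2 : Finset.image φ {i, j} = e := Finset.coe_injective (by simpa using h1.symm)
    exact h2 ▸ he

open scoped Classical in
/-- Blow-up: the edges are the sets mapped bijectively to edges of `P`. -/
noncomputable def comap (c : V → W) (P : RGraph W r) : RGraph V r where
  edges := (Finset.powersetCard r Finset.univ).filter fun e => e.image c ∈ P.edges
  uniform := fun _ he => (Finset.mem_powersetCard.mp (Finset.mem_filter.mp he).1).2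

theorem mem_edges_comap [DecidableEq W] {c : V → W} {P : RGraph W r} {e : Finset V} :
    e ∈ (comap c P).edges ↔ e.card = r ∧ e.image c ∈ P.edges := by
  simp only [comap, Finset.mem_filter, Finset.mem_powersetCard, Finset.subset_univ, true_and]
  congr!

/-- Adjacent vertices of a blow-up have distinct images, so a clique projects injectively to a
clique. -/
theorem free_complete_comap {m : ℕ} (c : V → W) {P : RGraph W 2}
    (hP : (complete (Fin m) 2).Free P) : (complete (Fin m) 2).Free (comap c P) := by
  classical
  rintro ⟨φ, hφ⟩
  have key : ∀ e ∈ (complete (Fin m) 2).edges, e.image (c ∘ φ) ∈ P.edges := fun e he => by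
    have := (mem_edges_comap.1 (isHom_iff.1 hφ e he)).2
    rwa [Finset.image_image] at this
  refine hP ⟨⟨c ∘ φ, fun i j hij => ?_⟩, isHom_iff.2 key⟩
  · by_contra hne
    have h1 := P.uniform _ (key {i, j} (mem_edges_complete.2 (Finset.card_pair hne)))
    rw [Finset.image_insert, Finset.image_singleton, hij] at h1
    simp at h1

theorem completePartite_eq_comap {k : ℕ} (c : V → Fin k) :
    completePartite c r = comap c (complete (Fin k) r) := by
  ext e
  rw [mem_edges_completePartite, mem_edges_comap, mem_edges_complete]
  refine and_congr_right fun h => ?_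
  rw [← h, Finset.card_image_iff]

theorem free_complete_succ_completePartite {ℓ : ℕ} (c : V → Fin ℓ) :
    (complete (Fin (ℓ + 1)) 2).Free (completePartite c 2) := by
  rw [completePartite_eq_comap]
  refine free_complete_comap c ?_
  rintro ⟨φ, -⟩
  simpa using Fintype.card_le_of_embedding φ

theorem relabel_turan (r n ℓ : ℕ) [NeZero ℓ] (σ : Fin n ≃ Fin n) :
    (turan r n ℓ).relabel σ = completePartite (residue ℓ σ) r := by
  ext e
  rw [mem_edges_completePartite]
  simp only [relabel, turan, Finset.mem_map]
  have hres : ∀ v : Fin n, residue ℓ σ (σ v) = Fin.ofNat ℓ v := fun v => by simp [residue]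
  constructor
  · rintro ⟨e, he, rfl⟩
    obtain ⟨h1, h2⟩ := mem_edges_completePartite.1 he
    refine ⟨by simpa using h1, ?_⟩
    simp only [RelEmbedding.coe_toEmbedding, Finset.mapEmbedding_apply, Finset.coe_map]
    rintro _ ⟨x, hx, rfl⟩ _ ⟨y, hy, rfl⟩ hxy
    simp only [Equiv.coe_toEmbedding, hres] at hxy ⊢
    rw [h2 hx hy (Fin.ext_iff.1 hxy)]
  · rintro ⟨h1, h2⟩
    refine ⟨e.map σ.symm.toEmbedding, mem_edges_completePartite.2 ⟨by simpa using h1, ?_⟩, ?_⟩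
    · simp only [Finset.coe_map]
      rintro _ ⟨x, hx, rfl⟩ _ ⟨y, hy, rfl⟩ hxy
      rw [h2 hx hy (Fin.ext hxy)]
    · ext x
      simp

open scoped Classical in
/-- The `r`-cliques of a graph. -/
noncomputable def cliques (G : SimpleGraph V) (r : ℕ) : RGraph V r where
  edges := (Finset.powersetCard r Finset.univ).filter fun e => G.IsClique (e : Set V)
  uniform := fun _ he => (Finset.mem_powersetCard.mp (Finset.mem_filter.mp he).1).2

theorem mem_edges_cliques {G : SimpleGraph V} {e : Finset V} :
    e ∈ (cliques G r).edges ↔ e.card = r ∧ G.IsClique e := by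
  simp [cliques]

theorem free_complete_cliques {m : ℕ} {G : SimpleGraph V} (hG : G.CliqueFree m) :
    (complete (Fin m) 2).Free (cliques G 2) := by
  rintro ⟨φ, hφ⟩
  refine (SimpleGraph.not_cliqueFree_iff_top_isContained m).2 ?_ hG
  refine ⟨⟨⟨φ, fun {i j} hij => ?_⟩, φ.injective⟩⟩
  have hne : i ≠ j := by simpa using hij
  obtain ⟨e, he, h⟩ := isHom_complete_two_iff.1 hφ i j hne
  have h2 := (mem_edges_cliques.1 he).2
  simp only at h
  rw [h] at h2
  exact h2 (by simp) (by simp) (φ.injective.ne hne)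

end Partite

/-- For `ℓ ≥ 2` there is a `K_{ℓ+1}`-free graph which is not `ℓ`-partite: the complement of a
cycle of length `2ℓ + 1`. -/
theorem exists_free_complete_not_isPartite {ℓ : ℕ} (hℓ : 2 ≤ ℓ) :
    ∃ P : RGraph (ZMod (2 * ℓ + 1)) 2,
      (complete (Fin (ℓ + 1)) 2).Free P ∧ ¬ P.IsPartite ℓ := by
  classical
  have h10 : (1 : ZMod (2 * ℓ + 1)) ≠ 0 := by
    have h := (ZMod.natCast_eq_zero_iff 1 (2 * ℓ + 1)).not.2 (Nat.not_dvd_of_pos_of_lt one_pos (by omega))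
    exact_mod_cast h
  have h30 : (3 : ZMod (2 * ℓ + 1)) ≠ 0 := by
    have h := (ZMod.natCast_eq_zero_iff 3 (2 * ℓ + 1)).not.2 (Nat.not_dvd_of_pos_of_lt (by omega) (by omega))
    exact_mod_cast h
  let G : SimpleGraph (ZMod (2 * ℓ + 1)) :=
    { Adj := fun x y => x ≠ y ∧ y ≠ x + 1 ∧ x ≠ y + 1
      symm := ⟨fun x y h => ⟨h.1.symm, h.2.2, h.2.1⟩⟩
      loopless := ⟨fun x h => h.1 rfl⟩ }
  refine ⟨cliques G 2, free_complete_cliques ?_, ?_⟩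
  · intro S hS
    -- A clique contains no two cyclically consecutive elements, so it is disjoint from its shift
    -- and has at most `ℓ` elements.
    have hd : Disjoint S (S.map (addRightEmbedding 1)) := by
      rw [Finset.disjoint_left]
      rintro x hx hx'
      obtain ⟨y, hy, hxy⟩ := Finset.mem_map.1 hx'
      simp only [addRightEmbedding_apply] at hxy
      subst hxy
      exact (hS.isClique hy hx (by simpa using h10)).2.1 rfl
    have h1 := Finset.card_le_univ (S.disjUnion _ hd)
    rw [Finset.card_disjUnion, Finset.card_map, hS.card_eq, ZMod.card] at h1
    omega
  · rw [isPartite_iff]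
    rintro ⟨c, hc⟩
    -- Elements of one colour are pairwise consecutive, and a cycle of length at least 5 has no
    -- triangle: three such elements would give `1 = 0` or `3 = 0`. So `ℓ` colours cover at most `2
    -- * ℓ` elements.
    have hcard : ∀ i : Fin ℓ, (Finset.univ.filter fun x => c x = i).card ≤ 2 := by
      intro i
      by_contra! h
      obtain ⟨x, y, z, hx, hy, hz, hxy, hxz, hyz⟩ := Finset.two_lt_card_iff.1 h
      simp only [Finset.mem_filter, Finset.mem_univ, true_and] at hx hy hz
      have key : ∀ a b, c a = i → c b = i → a ≠ b → b = a + 1 ∨ a = b + 1 := by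
        intro a b ha hb hab
        by_contra! hcon
        have hmem : ({a, b} : Finset _) ∈ (cliques G 2).edges := by
          rw [mem_edges_cliques]
          refine ⟨Finset.card_pair hab, ?_⟩
          rw [Finset.coe_pair, SimpleGraph.isClique_pair]
          exact fun _ => ⟨hab, hcon⟩
        exact hab (hc _ hmem (by simp) (by simp) (ha.trans hb.symm))
      rcases key x y hx hy hxy with h1 | h1 <;> rcases key x z hx hz hxz with h2 | h2 <;>
        rcases key y z hy hz hyz with h3 | h3
      · exact hyz (h1.trans h2.symm)
      · exact hyz (h1.trans h2.symm)
      · exact h30 (by linear_combination -h1 - h2 - h3)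
      · exact h10 (by linear_combination h3 - h1 - h2)
      · exact h10 (by linear_combination h3 - h1 - h2)
      · exact h30 (by linear_combination -h1 - h2 - h3)
      · exact hyz (add_right_cancel (h1.symm.trans h2))
      · exact hyz (add_right_cancel (h1.symm.trans h2))
    have h1 : (Finset.univ : Finset (ZMod (2 * ℓ + 1))).card ≤ 2 * (Finset.univ : Finset (Fin ℓ)).card :=
      Finset.card_le_mul_card_image_of_maps_to (f := c) (fun _ _ => Finset.mem_univ _) 2
        (fun i _ => hcard i)
    rw [Finset.card_univ, ZMod.card, Finset.card_univ, Fintype.card_fin] at h1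
    omega

/-! ### Expansions and thick pairs. -/

section Expansion

variable {V W : Type*} [Fintype V] {r : ℕ}

open Finset in
open scoped Classical in
theorem mem_edges_expansion {F : SimpleGraph V} {hr : 2 ≤ r}
    {E : Finset (V ⊕ (F.edgeSet × Fin (r - 2)))} :
    E ∈ (expansion F r hr).edges ↔ ∃ e : F.edgeSet,
      (e : Sym2 V).toFinset.disjSum (({e} : Finset F.edgeSet) ×ˢ (univ : Finset (Fin (r - 2)))) =
        E := by
  simp [expansion]

theorem edges_expansion_nonempty {F : SimpleGraph V} {hr : 2 ≤ r} {a b : V} (hab : F.Adj a b) :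
    (expansion F r hr).edges.Nonempty :=
  ⟨_, mem_edges_expansion.2 ⟨⟨s(a, b), hab⟩, rfl⟩⟩

/-- Complete `ℓ`-partite `r`-graphs contain no expansion of a graph which is not
`ℓ`-colourable. -/
theorem free_expansion_completePartite [Fintype W] {F : SimpleGraph V} {hr : 2 ≤ r} {ℓ : ℕ}
    (hF : ¬ F.Colorable ℓ) (c : W → Fin ℓ) :
    (expansion F r hr).Free (completePartite c r) := by
  classical
  rintro ⟨φ, hφ⟩
  rw [isHom_completePartite_iff] at hφ
  refine hF ⟨SimpleGraph.Coloring.mk (fun v => c (φ (Sum.inl v))) fun {a b} hab heq => ?_⟩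
  have h := hφ _ (mem_edges_expansion.2 ⟨⟨s(a, b), hab⟩, rfl⟩)
  have h1 := @h (Sum.inl a) (by simp) (Sum.inl b) (by simp) heq
  exact hab.ne (Sum.inl_injective h1)

/-- The pairs of vertices which, for every set `S` of at most `k` other vertices, lie in an edge
avoiding `S`. -/
def thickGraph (H : RGraph W r) (k : ℕ) : SimpleGraph W where
  Adj u v := u ≠ v ∧ ∀ S : Finset W, S.card ≤ k → u ∉ S → v ∉ S →
    ∃ e ∈ H.edges, u ∈ e ∧ v ∈ e ∧ Disjoint e S
  symm := ⟨fun _ _ h => ⟨h.1.symm, fun S hS hu hv => by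
    obtain ⟨e, he, h1, h2, h3⟩ := h.2 S hS hv hu
    exact ⟨e, he, h2, h1, h3⟩⟩⟩
  loopless := ⟨fun _ h => h.1 rfl⟩

open Finset in
open scoped Classical in
/-- Few edges contain a pair which is not thick. -/
theorem card_edges_not_isClique_thickGraph_mul_le [Fintype W] (H : RGraph W r) (k : ℕ) :
    #(H.edges.filter fun e : Finset W => ¬ (H.thickGraph k).IsClique (e : Set W)) * Fintype.card W ≤
      k * Fintype.card W ^ r := by
  rcases Nat.eq_zero_or_pos (Fintype.card W) with h0 | hpos
  · rw [h0, mul_zero]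
    exact Nat.zero_le _
  have hS : ∀ p : W × W, ∃ S : Finset W, S.card ≤ k ∧ (p.1 ≠ p.2 → ¬ (H.thickGraph k).Adj p.1 p.2 →
      p.1 ∉ S ∧ p.2 ∉ S ∧ ∀ e ∈ H.edges, p.1 ∈ e → p.2 ∈ e → ¬ Disjoint e S) := by
    intro p
    by_cases h : p.1 ≠ p.2 ∧ ¬ (H.thickGraph k).Adj p.1 p.2
    · obtain ⟨h1, h2⟩ := h
      simp only [thickGraph] at h2
      push Not at h2
      obtain ⟨S, hS, h3, h4, h5⟩ := h2 h1
      exact ⟨S, hS, fun _ _ => ⟨h3, h4, h5⟩⟩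
    · exact ⟨∅, by simp, fun h1 h2 => absurd ⟨h1, h2⟩ h⟩
  choose S hSk hS using hS
  -- An edge through a non-thick pair `p` meets `S p`, hence contains one of at most `k * n ^ 2`
  -- triples. The filter discards degenerate triples coming from irrelevant `p`.
  let T : Finset (Finset W) := {t ∈ (univ : Finset (W × W)).biUnion fun p =>
    (S p).image fun s => {p.1, p.2, s} | #t = 3}
  have hT : #T ≤ Fintype.card W ^ 2 * k := by
    calc #T ≤ _ := card_filter_le _ _
      _ ≤ #(univ : Finset (W × W)) * k := card_biUnion_le_card_mul _ _ _ fun p _ =>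
          card_image_le.trans (hSk p)
      _ = _ := by rw [card_univ, Fintype.card_prod, sq]
  have hsub : (H.edges.filter fun e : Finset W => ¬ (H.thickGraph k).IsClique (e : Set W)) ⊆
      {e ∈ powersetCard r (univ : Finset W) | ∃ t ∈ T, t ⊆ e} := by
    intro e he
    obtain ⟨he, hcl⟩ := mem_filter.1 he
    refine mem_filter.2 ⟨mem_powersetCard.2 ⟨subset_univ _, H.uniform e he⟩, ?_⟩
    rw [SimpleGraph.isClique_iff, Set.Pairwise] at hcl
    push Not at hcl
    obtain ⟨u, hu, v, hv, huv, hadj⟩ := hcl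
    obtain ⟨h1, h2, h3⟩ := hS (u, v) huv hadj
    obtain ⟨s, hse, hsS⟩ := not_disjoint_iff.1 (h3 e he hu hv)
    refine ⟨{u, v, s}, mem_filter.2 ⟨mem_biUnion.2 ⟨(u, v), mem_univ _,
      mem_image.2 ⟨s, hsS, rfl⟩⟩, ?_⟩, ?_⟩
    · exact card_eq_three.2 ⟨u, v, s, huv, fun h => h1 (h ▸ hsS), fun h => h2 (h ▸ hsS), rfl⟩
    · simp only [insert_subset_iff, singleton_subset_iff]
      exact ⟨hu, hv, hse⟩
  have h1 := card_powersetCard_superset_mul_le T (s := 3) r fun t ht => (mem_filter.1 ht).2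
  have h2 : #(H.edges.filter fun e : Finset W => ¬ (H.thickGraph k).IsClique (e : Set W)) * Fintype.card W ^ 3 ≤
      Fintype.card W ^ 2 * k * Fintype.card W ^ r :=
    (Nat.mul_le_mul_right _ (card_le_card hsub)).trans (h1.trans (Nat.mul_le_mul_right _ hT))
  refine Nat.le_of_mul_le_mul_left ?_ (pow_pos hpos 2)
  calc _ = #(H.edges.filter fun e : Finset W => ¬ (H.thickGraph k).IsClique (e : Set W)) * Fintype.card W ^ 3 := by ring
    _ ≤ _ := h2
    _ = _ := by ring

open Finset in
open scoped Classical in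
/-- A copy of `F` among the thick pairs extends to a copy of the expansion. -/
theorem exists_isHom_expansion_of_thickGraph (F : SimpleGraph V) (hr : 2 ≤ r) (H : RGraph W r)
    (f : V → W) (hf : Function.Injective f)
    (hadj : ∀ a b, F.Adj a b →
      (H.thickGraph (Fintype.card V + Fintype.card F.edgeSet * r)).Adj (f a) (f b)) :
    ∃ φ : (V ⊕ (F.edgeSet × Fin (r - 2))) ↪ W, (expansion F r hr).IsHom H φ := by
  have key : ∀ T : Finset F.edgeSet, ∃ g : F.edgeSet → Finset W,
      (∀ e ∈ T, g e ∈ H.edges ∧ (e : Sym2 V).toFinset.image f ⊆ g e ∧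
        Disjoint (g e \ (e : Sym2 V).toFinset.image f) (univ.image f)) ∧
      ∀ e ∈ T, ∀ e' ∈ T, e ≠ e' → Disjoint (g e \ (e : Sym2 V).toFinset.image f)
        (g e' \ (e' : Sym2 V).toFinset.image f) := by
    intro T
    induction T using Finset.induction_on with
    | empty => exact ⟨fun _ => ∅, by simp, by simp⟩
    | insert e T heT ih =>
      obtain ⟨g, hg1, hg2⟩ := ih
      obtain ⟨⟨e, he⟩, rfl⟩ : ∃ e' : F.edgeSet, e' = e := ⟨e, rfl⟩
      induction e with | _ a b =>
      -- The next edge must avoid the copy of `F` and the edges chosen earlier, except at its two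
      -- ends; the thickness parameter is an upper bound for the size of this set.
      set S : Finset W := (univ.image f ∪ T.biUnion g) \ {f a, f b} with hS
      have hScard : #S ≤ Fintype.card V + Fintype.card F.edgeSet * r := by
        calc #S ≤ #(univ.image f ∪ T.biUnion g) := card_le_card sdiff_subset
          _ ≤ #(univ.image f) + #(T.biUnion g) := card_union_le _ _
          _ ≤ Fintype.card V + #T * r := by
              gcongr
              · exact card_image_le
              · exact card_biUnion_le_card_mul _ _ _ fun e he => (H.uniform _ (hg1 e he).1).le
          _ ≤ _ := by
              gcongr
              exact card_le_univ T
      obtain ⟨E, hE, haE, hbE, hES⟩ := (hadj a b he).2 S hScard (by simp [hS]) (by simp [hS])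
      have himg : (s(a, b) : Sym2 V).toFinset.image f = {f a, f b} := by
        ext x
        simp [Sym2.mem_toFinset, eq_comm]
      have hdis : Disjoint (E \ {f a, f b}) (univ.image f ∪ T.biUnion g) := by
        rw [disjoint_left]
        intro x hx hx'
        rw [mem_sdiff] at hx
        exact disjoint_left.1 hES hx.1 (mem_sdiff.2 ⟨hx', hx.2⟩)
      rw [disjoint_union_right] at hdis
      have hgT : ∀ e' ∈ T, Function.update g ⟨s(a, b), he⟩ E e' = g e' := fun e' he' =>
        Function.update_of_ne (ne_of_mem_of_not_mem he' heT) _ _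
      refine ⟨Function.update g ⟨s(a, b), he⟩ E, ?_, ?_⟩
      · intro e' he'
        rcases mem_insert.1 he' with rfl | he''
        · rw [Function.update_self, himg]
          refine ⟨hE, ?_, hdis.1⟩
          simp only [insert_subset_iff, singleton_subset_iff]
          exact ⟨haE, hbE⟩
        · rw [hgT e' he'']
          exact hg1 e' he''
      · have hnew : ∀ e' ∈ T, Disjoint (E \ {f a, f b})
            (g e' \ (e' : Sym2 V).toFinset.image f) := fun e' he' =>
          hdis.2.mono_right (sdiff_subset.trans (subset_biUnion_of_mem g he'))
        intro e₁ h₁ e₂ h₂ hne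
        rcases mem_insert.1 h₁ with rfl | h₁' <;> rcases mem_insert.1 h₂ with rfl | h₂'
        · exact absurd rfl hne
        · rw [Function.update_self, hgT e₂ h₂', himg]
          exact hnew e₂ h₂'
        · rw [Function.update_self, hgT e₁ h₁', himg]
          exact (hnew e₁ h₁').symm
        · rw [hgT e₁ h₁', hgT e₂ h₂']
          exact hg2 e₁ h₁' e₂ h₂' hne
  obtain ⟨g, hg1, hg2⟩ := key univ
  let D : F.edgeSet → Finset W := fun e => g e \ (e : Sym2 V).toFinset.image f
  have hD : ∀ e, #(D e) = r - 2 := fun e => by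
    rw [card_sdiff_of_subset (hg1 e (mem_univ _)).2.1, H.uniform _ (hg1 e (mem_univ _)).1,
      card_image_of_injective _ hf,
      Sym2.card_toFinset_of_not_isDiag _ (F.not_isDiag_of_mem_edgeSet e.2)]
  -- The new vertices of each edge of `F` are identified with the `r - 2` vertices remaining in the
  -- chosen edge of `H`.
  let ψ : ∀ e, D e ≃ Fin (r - 2) := fun e => (D e).equivFinOfCardEq (hD e)
  let φ : V ⊕ (F.edgeSet × Fin (r - 2)) → W := Sum.elim f fun p => (ψ p.1).symm p.2
  have hfD : ∀ v (p : F.edgeSet × Fin (r - 2)), f v ≠ (ψ p.1).symm p.2 := fun v p h =>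
    disjoint_left.1 (hg1 p.1 (mem_univ _)).2.2 ((ψ p.1).symm p.2).2
      (h ▸ mem_image_of_mem f (mem_univ v))
  have hφ : Function.Injective φ := by
    refine Function.Injective.sumElim hf ?_ hfD
    rintro ⟨e, i⟩ ⟨e', i'⟩ h
    by_cases hee : e = e'
    · subst hee
      have := (ψ e).symm.injective (Subtype.ext h)
      exact congrArg (Prod.mk e) this
    · have h1 : ((ψ e).symm i : W) = (ψ e').symm i' := h
      exact absurd ((ψ e').symm i').2
        (disjoint_left.1 (hg2 e (mem_univ _) e' (mem_univ _) hee) (h1 ▸ ((ψ e).symm i).2))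
  refine ⟨⟨φ, hφ⟩, fun E hE => ?_⟩
  obtain ⟨e, rfl⟩ := mem_edges_expansion.1 hE
  convert (hg1 e (mem_univ _)).1
  ext x
  simp only [mem_image, Function.Embedding.coeFn_mk]
  constructor
  · rintro ⟨v | ⟨e', i⟩, hv, rfl⟩
    · exact (hg1 e (mem_univ _)).2.1 (mem_image_of_mem f (by simpa using hv))
    · obtain rfl : e = e' := by simpa using hv
      exact (mem_sdiff.1 ((ψ e).symm i).2).1
  · intro hx
    by_cases hxf : x ∈ (e : Sym2 V).toFinset.image f
    · obtain ⟨v, hv, rfl⟩ := mem_image.1 hxf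
      exact ⟨Sum.inl v, by simpa using hv, rfl⟩
    · refine ⟨Sum.inr (e, ψ e ⟨x, mem_sdiff.2 ⟨hx, hxf⟩⟩), by simp, ?_⟩
      simp [φ]

end Expansion

end RGraph

/-! ### Consequences of stability and passage to the shadow. -/

namespace RGraph

section Stability

variable {U V W X : Type*} [Fintype U] [Fintype V] [Fintype W] {r ℓ : ℕ}

theorem exists_le_inj_completePartite [NeZero ℓ] {P : RGraph U r} (hP : P.IsPartite ℓ) :
    ∃ κ : ℝ, 0 < κ ∧ ∃ N : ℕ, ∀ n, N ≤ n → ∀ σ : Fin n ≃ Fin n,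
      κ * (n : ℝ) ^ Fintype.card U ≤ P.inj (completePartite (residue ℓ σ) r) := by
  obtain ⟨ψ, hψ⟩ := isPartite_iff.1 hP
  obtain ⟨κ, hκ, N, hN⟩ := exists_le_card_embedding_residue U ℓ 0
  refine ⟨κ, hκ, N + 1, fun n hn σ => ?_⟩
  have h := hN n (by omega) σ ψ ∅ (fun _ => ⟨0, by omega⟩) rfl (by simp) (by simp)
  rw [Nat.sub_zero] at h
  refine h.trans (Nat.cast_le.2 (Nat.card_mono (Set.toFinite _) ?_))
  rintro φ ⟨hφ, -⟩
  refine isHom_completePartite_iff.2 fun E hE => ?_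
  have : residue ℓ σ ∘ φ = ψ := funext hφ
  rw [this]
  exact hψ E hE

/-- In the balanced blow-up of `P`, choosing each vertex from its own class always gives a copy of
`P`. -/
theorem exists_le_inj_comap [Nonempty W] (P : RGraph W r) :
    ∃ κ : ℝ, 0 < κ ∧ ∃ N : ℕ, ∀ n, N ≤ n → ∃ c : Fin n → W,
      κ * (n : ℝ) ^ Fintype.card W ≤ P.inj (comap c P) := by
  classical
  have : NeZero (Fintype.card W) := ⟨Fintype.card_ne_zero⟩
  obtain ⟨κ, hκ, N, hN⟩ := exists_le_card_embedding_residue W (Fintype.card W) 0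
  let ι := Fintype.equivFin W
  refine ⟨κ, hκ, N + 1, fun n hn => ⟨fun v => ι.symm (residue _ (Equiv.refl _) v), ?_⟩⟩
  have h := hN n (by omega) (Equiv.refl _) ι ∅ (fun _ => ⟨0, by omega⟩) rfl (by simp) (by simp)
  rw [Nat.sub_zero] at h
  refine h.trans (Nat.cast_le.2 (Nat.card_mono (Set.toFinite _) ?_))
  rintro φ ⟨hφ, -⟩
  refine isHom_iff.2 fun E hE => mem_edges_comap.2 ⟨?_, ?_⟩
  · rw [Finset.card_image_of_injective _ φ.injective, P.uniform E hE]
  · rw [Finset.image_image]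
    have : (fun v => ι.symm (residue _ (Equiv.refl _) v)) ∘ φ = id := funext fun u => by
      simp [hφ]
    rwa [this, Finset.image_id]

/-- The sub-`r`-graph obtained by deleting some edges. -/
def deleteEdges [DecidableEq V] (H : RGraph V r) (S : Finset (Finset V)) : RGraph V r where
  edges := H.edges \ S
  uniform := fun e he => H.uniform e (Finset.mem_sdiff.1 he).1

theorem edges_complete_nonempty {m : ℕ} (hm : 2 ≤ m) : (complete (Fin m) 2).edges.Nonempty := by
  refine ⟨{⟨0, by omega⟩, ⟨1, by omega⟩}, mem_edges_complete.2 (Finset.card_pair ?_)⟩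
  simp

omit [Fintype V] [Fintype U] in
theorem IsHom.isPartite {P : RGraph U r} {G : RGraph V r} {φ : U → V} (hφ : P.IsHom G φ)
    (hG : G.IsPartite ℓ) : P.IsPartite ℓ := by
  classical
  obtain ⟨c, hc⟩ := isPartite_iff.1 hG
  refine isPartite_iff.2 ⟨c ∘ φ, fun E hE => ?_⟩
  have h1 := isHom_iff.1 hφ E hE
  have h2 := hc _ h1
  have h3 : Set.InjOn φ E := Finset.card_image_iff.1 ((G.uniform _ h1).trans (P.uniform E hE).symm)
  refine h2.comp h3 fun x hx => ?_
  simpa using ⟨x, hx, rfl⟩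

omit [Fintype V] [Fintype U] in
theorem inj_eq_zero {P : RGraph U r} {G : RGraph V r} (h : P.Free G) : P.inj G = 0 := by
  have : IsEmpty {φ : U ↪ V // P.IsHom G φ} := ⟨fun φ => h ⟨φ.1, φ.2⟩⟩
  exact Nat.card_of_isEmpty

omit [Fintype U] in
/-- Edge-stability is violated if nearly extremal graphs can contain many copies of a graph which is
not `ℓ`-partite. -/
theorem not_isEdgeStable_of_many_copies {A : RGraph X r} {Q : RGraph U r} {P : RGraph W r}
    (hP : ¬ P.IsPartite ℓ) {κ : ℝ} (hκ : 0 < κ) {N : ℕ}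
    (h : ∀ n, N ≤ n → ∃ G : RGraph (Fin n) r, A.Free G ∧ injMax n Q A ≤ Q.inj G ∧
      κ * (n : ℝ) ^ Fintype.card W ≤ P.inj G) :
    ¬ A.IsEdgeStable Q (fun _ => {G | G.IsPartite ℓ}) := by
  intro hstab
  set m : ℝ := P.edges.card * r ^ r with hm
  have hm0 : 0 ≤ m := by positivity
  -- Making the graph `ℓ`-partite destroys all copies of `P`, yet with this `ε` the deleted edges
  -- meet fewer than `κ * n ^ |W|` of them.
  obtain ⟨δ, hδ, N', hN'⟩ := hstab (κ / (2 * (m + 1))) (by positivity)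
  set n := max (max N N') 1
  have hn1 : 1 ≤ n := le_max_right _ _
  obtain ⟨G, hG, hmax, hmany⟩ := h n ((le_max_left _ _).trans (le_max_left _ _))
  obtain ⟨G', hpart, -, hcard⟩ := hN' n ((le_max_right _ _).trans (le_max_left _ _)) G hG (by
    have h1 : (injMax n Q A : ℝ) ≤ Q.inj G := by exact_mod_cast hmax
    have h2 : 0 ≤ δ * (injMax n Q A : ℝ) := by positivity
    linarith)
  have h1 := inj_le_inj_add P G P G' (G.edges \ G'.edges)
    (fun e he => G.uniform e (Finset.mem_sdiff.1 he).1)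
    (fun φ hφ hav => isHom_iff_map.2 fun E hE => by
      by_contra hE'
      exact hav E hE (Finset.mem_sdiff.2 ⟨isHom_iff_map.1 hφ E hE, hE'⟩))
    (ε := κ / (2 * (m + 1))) (by rw [Fintype.card_fin]; exact hn1) (by simpa using hcard)
  rw [inj_eq_zero (fun ⟨φ, hφ⟩ => hP (hφ.isPartite hpart))] at h1
  simp only [Fintype.card_fin, Nat.cast_zero, zero_add, ← hm] at h1
  have hpos : (0 : ℝ) < (n : ℝ) ^ Fintype.card W := by positivity
  have h2 := le_of_mul_le_mul_right (hmany.trans h1) hpos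
  have h3 : m * (κ / (2 * (m + 1))) < κ := by
    rw [mul_div_assoc', div_lt_iff₀ (by positivity)]
    nlinarith
  linarith

/-- Suppose `P` is not `ℓ`-partite. If it is $K_{\ell+1}$-free, extremal graphs contain at least as
many copies of `P` as its blow-up does, so they are far from `ℓ`-partite. Otherwise the maximum is
0, every $K_{\ell+1}$-free graph is extremal, and a blow-up of the complement of an odd cycle
violates stability. The lower bound lets additive errors be absorbed as relative ones. -/
theorem isEdgeStable_isPartite_and_exists_le_injMax (hℓ : 2 ≤ ℓ) {P : RGraph U 2}
    (hstab : (complete (Fin (ℓ + 1)) 2).IsEdgeStable P (fun _ => {G | G.IsPartite ℓ})) :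
    P.IsPartite ℓ ∧ ∃ κ : ℝ, 0 < κ ∧ ∃ N : ℕ, ∀ n, N ≤ n →
      κ * (n : ℝ) ^ Fintype.card U ≤ injMax n P (complete (Fin (ℓ + 1)) 2) := by
  have : NeZero ℓ := ⟨by omega⟩
  have hmax := fun n => isGreatest_injMax n P (complete (Fin (ℓ + 1)) 2)
    (edges_complete_nonempty (by omega))
  have hpart : P.IsPartite ℓ := by
    by_contra hP
    by_cases hfree : (complete (Fin (ℓ + 1)) 2).Free P
    · have : Nonempty U := by
        by_contra hU
        rw [not_nonempty_iff] at hU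
        exact hP (isPartite_iff.2 ⟨hU.elim, fun e _ x => hU.elim x⟩)
      obtain ⟨κ, hκ, N, hN⟩ := exists_le_inj_comap P
      refine not_isEdgeStable_of_many_copies hP hκ (N := N) (fun n hn => ?_) hstab
      obtain ⟨c, hc⟩ := hN n hn
      obtain ⟨G, hG, hGeq⟩ := (hmax n).1
      refine ⟨G, hG, hGeq.ge, hc.trans ?_⟩
      rw [hGeq]
      exact_mod_cast (hmax n).2 ⟨_, free_complete_comap c hfree, rfl⟩
    · obtain ⟨P₀, hP₀, hP₀'⟩ := exists_free_complete_not_isPartite hℓ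
      obtain ⟨κ, hκ, N, hN⟩ := exists_le_inj_comap P₀
      refine not_isEdgeStable_of_many_copies hP₀' hκ (N := N) (fun n hn => ?_) hstab
      obtain ⟨c, hc⟩ := hN n hn
      refine ⟨_, free_complete_comap c hP₀, ?_, hc⟩
      obtain ⟨G, hG, hGeq⟩ := (hmax n).1
      have hPG : P.Free G := by
        rintro ⟨φ, hφ⟩
        classical
        obtain ⟨ψ, hψ⟩ := not_not.1 hfree
        refine hG ⟨ψ.trans φ, isHom_iff.2 fun e he => ?_⟩
        have := isHom_iff.1 hφ _ (isHom_iff.1 hψ e he)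
        rw [Finset.image_image] at this
        exact this
      rw [← hGeq, inj_eq_zero hPG]
      exact Nat.zero_le _
  refine ⟨hpart, ?_⟩
  obtain ⟨κ, hκ, N, hN⟩ := exists_le_inj_completePartite hpart
  refine ⟨κ, hκ, N, fun n hn => (hN n hn (Equiv.refl _)).trans ?_⟩
  exact_mod_cast (hmax n).2 ⟨_, free_complete_succ_completePartite _, rfl⟩

/-- The extremal number of the shadow is at most that of the `r`-graph, up to a small error. -/
theorem exists_injMax_shadow_le (hℓ : 2 ≤ ℓ) {Q : RGraph U r} {A : RGraph X r}
    (hA : A.edges.Nonempty) (hfree : ∀ n (c : Fin n → Fin ℓ), A.Free (completePartite c r))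
    (hstab : (complete (Fin (ℓ + 1)) 2).IsEdgeStable (Q.shadow 2) (fun _ => {G | G.IsPartite ℓ}))
    {ε : ℝ} (hε : 0 < ε) :
    ∃ N : ℕ, ∀ n, N ≤ n → (injMax n (Q.shadow 2) (complete (Fin (ℓ + 1)) 2) : ℝ) ≤
      injMax n Q A + ε * (n : ℝ) ^ Fintype.card U := by
  set m : ℝ := (Q.shadow 2).edges.card * (2 : ℕ) ^ 2 with hm
  have hm0 : 0 ≤ m := by positivity
  obtain ⟨δ, hδ, N, hN⟩ := hstab (ε / (m + 1)) (by positivity)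
  refine ⟨N + 1, fun n hn => ?_⟩
  obtain ⟨G, hG, hGeq⟩ := (isGreatest_injMax n (Q.shadow 2) (complete (Fin (ℓ + 1)) 2)
    (edges_complete_nonempty (by omega))).1
  obtain ⟨G', hpart, -, hcard⟩ := hN n (by omega) G hG (by
    rw [← hGeq]
    have h2 : 0 ≤ δ * ((Q.shadow 2).inj G : ℝ) := by positivity
    linarith)
  obtain ⟨c, hc⟩ := isPartite_iff.1 hpart
  -- Copies of the shadow in the extremal `G` that avoid the deleted pairs are properly coloured by
  -- `c`, hence are copies of `Q` in the complete partite `r`-graph.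
  have h1 := inj_le_inj_add (Q.shadow 2) G Q (completePartite c r) (G.edges \ G'.edges)
    (fun e he => G.uniform e (Finset.mem_sdiff.1 he).1)
    (fun φ hφ hav => isHom_shadow_completePartite_iff.1 (isHom_iff_map.2 fun p hp => by
      have hpG := isHom_iff_map.1 hφ p hp
      refine mem_edges_completePartite.2 ⟨G.uniform _ hpG, hc _ ?_⟩
      by_contra hE'
      exact hav p hp (Finset.mem_sdiff.2 ⟨hpG, hE'⟩)))
    (ε := ε / (m + 1)) (by simp; omega) (by simpa using hcard)
  rw [← hm, hGeq] at h1
  have h2 : (Q.inj (completePartite c r) : ℝ) ≤ injMax n Q A := by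
    exact_mod_cast (isGreatest_injMax n Q A hA).2 ⟨_, hfree n c, rfl⟩
  have h3 : m * (ε / (m + 1)) ≤ ε := by
    rw [mul_div_assoc', div_le_iff₀ (by positivity)]
    nlinarith
  simp only [Fintype.card_fin] at h1
  have h4 : m * (ε / (m + 1)) * (n : ℝ) ^ Fintype.card U ≤ ε * (n : ℝ) ^ Fintype.card U := by
    gcongr
  linarith

open scoped Classical in
/-- The edges of `H` containing a pair which is not an edge of `G`. -/
noncomputable def uncovered (H : RGraph V r) (G : RGraph V 2) : Finset (Finset V) :=
  H.edges.filter fun e => ∃ p ⊆ e, p.card = 2 ∧ p ∉ G.edges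

omit [Fintype V] in
theorem mem_uncovered {H : RGraph V r} {G : RGraph V 2} {e : Finset V} :
    e ∈ H.uncovered G ↔ e ∈ H.edges ∧ ∃ p ⊆ e, p.card = 2 ∧ p ∉ G.edges := by
  simp [uncovered]

omit [Fintype V] in
theorem mem_edges_of_notMem_uncovered {H : RGraph V r} {G : RGraph V 2} {e p : Finset V}
    (he : e ∈ H.edges) (hG : e ∉ H.uncovered G) (hpe : p ⊆ e) (hp : p.card = 2) : p ∈ G.edges := by
  by_contra h
  exact hG (mem_uncovered.2 ⟨he, p, hpe, hp, h⟩)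

-- Every pair lies in at most $n^{r-2}$ sets of size $r$, so deleting few pairs from `G` uncovers
-- few further edges of `H`.
open Finset in
theorem card_uncovered_le [DecidableEq V] (H : RGraph V r) (G G' : RGraph V 2) {ε : ℝ}
    (hV : 0 < Fintype.card V)
    (hε : (#(G.edges \ G'.edges) : ℝ) ≤ ε * (Fintype.card V : ℝ) ^ 2) :
    (#(H.uncovered G') : ℝ) ≤ #(H.uncovered G) + ε * (Fintype.card V : ℝ) ^ r := by
  have h1 := card_powersetCard_superset_mul_le (G.edges \ G'.edges) r
    (fun t ht => G.uniform t (mem_sdiff.1 ht).1)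
  have hsub : H.uncovered G' ⊆ H.uncovered G ∪
      (powersetCard r (univ : Finset V)).filter fun e => ∃ t ∈ G.edges \ G'.edges, t ⊆ e := by
    intro e he
    obtain ⟨heH, p, hpe, hp, hpG⟩ := mem_uncovered.1 he
    by_cases hG : p ∈ G.edges
    · exact mem_union_right _ (mem_filter.2 ⟨mem_powersetCard.2 ⟨subset_univ _, H.uniform e heH⟩,
        p, mem_sdiff.2 ⟨hG, hpG⟩, hpe⟩)
    · exact mem_union_left _ (mem_uncovered.2 ⟨heH, p, hpe, hp, hG⟩)
  have h2 := (card_le_card hsub).trans (card_union_le _ _)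
  have h3 : (#((powersetCard r (univ : Finset V)).filter fun e =>
      ∃ t ∈ G.edges \ G'.edges, t ⊆ e) : ℝ) ≤ ε * (Fintype.card V : ℝ) ^ r := by
    have hpos : (0 : ℝ) < (Fintype.card V : ℝ) ^ 2 := by positivity
    refine le_of_mul_le_mul_right ?_ hpos
    calc _ ≤ (#(G.edges \ G'.edges) : ℝ) * (Fintype.card V : ℝ) ^ r := by
          convert (Nat.cast_le (α := ℝ)).2 h1 <;> push_cast <;> congr!
      _ ≤ ε * (Fintype.card V : ℝ) ^ 2 * (Fintype.card V : ℝ) ^ r := by gcongr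
      _ = _ := by ring
  calc (#(H.uncovered G') : ℝ) ≤ #(H.uncovered G) +
        #((powersetCard r (univ : Finset V)).filter fun e => ∃ t ∈ G.edges \ G'.edges, t ⊆ e) := by
        exact_mod_cast h2
    _ ≤ _ := by gcongr

/-- All but few edges of an `H_F^r`-free `r`-graph are cliques of a `K_k`-free graph. -/
theorem exists_free_complete_card_uncovered_le (F : SimpleGraph V) {k : ℕ} (hF : F.Colorable k)
    (hr : 2 ≤ r) {ε : ℝ} (hε : 0 < ε) :
    ∃ N : ℕ, ∀ n, N ≤ n → ∀ H : RGraph (Fin n) r, (expansion F r hr).Free H →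
      ∃ G : RGraph (Fin n) 2, (complete (Fin k) 2).Free G ∧
        ((H.uncovered G).card : ℝ) ≤ ε * (n : ℝ) ^ r := by
  classical
  obtain ⟨N, hN⟩ := SimpleGraph.exists_cliqueFree_le_of_colorable F hF (half_pos hε)
  set K := Fintype.card V + Fintype.card F.edgeSet * r
  refine ⟨max N ⌈2 * K / ε⌉₊ + 1, fun n hn H hH => ?_⟩
  have hn0 : 0 < n := by omega
  have hKn : K ≤ ε / 2 * n := by
    have h1 : (2 * K / ε : ℝ) ≤ n := (Nat.le_ceil _).trans
      (by exact_mod_cast (le_max_right _ _).trans ((Nat.le_succ _).trans hn))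
    rw [div_le_iff₀ hε] at h1
    linarith
  -- The thick graph is `F`-free, so the removal lemma applies to it. Half of `ε` pays for edges
  -- with a non-thick pair, half for removed pairs.
  obtain ⟨G, hGle, hGfree, hGcard⟩ := hN n (by omega) (H.thickGraph K) (by
    rintro ⟨f, hf, hadj⟩
    refine hH (exists_isHom_expansion_of_thickGraph F hr H f hf fun a b hab => ?_)
    convert hadj a b hab)
  refine ⟨cliques G 2, free_complete_cliques hGfree, ?_⟩
  have h1 : ((H.uncovered (cliques (H.thickGraph K) 2)).card : ℝ) ≤ ε / 2 * (n : ℝ) ^ r := by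
    have h2 := card_edges_not_isClique_thickGraph_mul_le H K
    have hsub : H.uncovered (cliques (H.thickGraph K) 2) ⊆
        H.edges.filter fun e => ¬ (H.thickGraph K).IsClique (e : Set (Fin n)) := by
      intro e he
      obtain ⟨heH, p, hpe, hp, hpG⟩ := mem_uncovered.1 he
      refine Finset.mem_filter.2 ⟨heH, fun hcl => hpG (mem_edges_cliques.2 ⟨hp, ?_⟩)⟩
      exact hcl.subset (Finset.coe_subset.2 hpe)
    have h3 : ((H.uncovered (cliques (H.thickGraph K) 2)).card : ℝ) * n ≤ K * (n : ℝ) ^ r := by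
      have := (Nat.mul_le_mul_right (Fintype.card (Fin n)) (Finset.card_le_card hsub)).trans
        (le_of_eq_of_le (by congr!) h2)
      simp only [Fintype.card_fin] at this
      exact_mod_cast this
    have hnR : (0 : ℝ) < n := by exact_mod_cast hn0
    refine le_of_mul_le_mul_right (h3.trans ?_) hnR
    calc (K : ℝ) * (n : ℝ) ^ r ≤ ε / 2 * n * (n : ℝ) ^ r := by gcongr
      _ = _ := by ring
  have h2 : (((cliques (H.thickGraph K) 2).edges \ (cliques G 2).edges).card : ℝ) ≤
      ε / 2 * (n : ℝ) ^ 2 := by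
    refine le_trans ?_ hGcard
    rw [Nat.card_eq_fintype_card, Fintype.card_subtype]
    refine Nat.cast_le.2 ((Finset.card_le_card ?_).trans
      (Finset.card_image_le (f := fun p : Fin n × Fin n => ({p.1, p.2} : Finset (Fin n)))))
    intro e he
    obtain ⟨h3, h4⟩ := Finset.mem_sdiff.1 he
    obtain ⟨h5, h6⟩ := mem_edges_cliques.1 h3
    obtain ⟨x, y, hxy, rfl⟩ := Finset.card_eq_two.1 h5
    refine Finset.mem_image.2 ⟨(x, y), Finset.mem_filter.2 ⟨Finset.mem_univ _, ?_, ?_⟩, rfl⟩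
    · exact h6 (by simp) (by simp) hxy
    · intro hG
      refine h4 (mem_edges_cliques.2 ⟨h5, ?_⟩)
      rw [Finset.coe_pair, SimpleGraph.isClique_pair]
      exact fun _ => hG
  have h3 := card_uncovered_le H (cliques (H.thickGraph K) 2) (cliques G 2) (ε := ε / 2)
    (by simpa using hn0) (by simpa using h2)
  simp only [Fintype.card_fin] at h3
  linarith

end Stability

end RGraph

/-! ### The two transfer theorems. -/

namespace RGraph

section Main

variable {U V X : Type*} [Fintype U] [Fintype V] {r ℓ : ℕ}

omit [Fintype U] [Fintype V] in
theorem IsHom.shadow_of_notMem_uncovered [Fintype U] {Q : RGraph U r} {H : RGraph V r}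
    {G : RGraph V 2} {φ : U ↪ V} (hφ : Q.IsHom H φ)
    (h : ∀ E ∈ Q.edges, E.map φ ∉ H.uncovered G) : (Q.shadow 2).IsHom G φ := by
  refine isHom_iff_map.2 fun p hp => ?_
  obtain ⟨hp2, E, hE, hpE⟩ := mem_edges_shadow.1 hp
  exact mem_edges_of_notMem_uncovered (isHom_iff_map.1 hφ E hE) (h E hE)
    (Finset.map_subset_map.2 hpE) (by rw [Finset.card_map, hp2])

theorem edges_expansion_nonempty_of_not_colorable {F : SimpleGraph V} {hr : 2 ≤ r} (hℓ : 0 < ℓ)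
    (hF : ¬ F.Colorable ℓ) : (expansion F r hr).edges.Nonempty := by
  by_contra h
  refine hF ⟨SimpleGraph.Coloring.mk (fun _ => ⟨0, hℓ⟩) fun {a b} hab => ?_⟩
  exact absurd (edges_expansion_nonempty hab) h

/-- A nearly extremal `H_F^r`-free `r`-graph is, up to few edges, contained in the cliques of a
`K_{ℓ+1}`-free graph which is nearly extremal for the shadow. -/
theorem exists_nearly_extremal_shadow (hℓ : 2 ≤ ℓ) (hr : 2 ≤ r) (Q : RGraph U r)
    {F : SimpleGraph V} (hF : F.Colorable (ℓ + 1)) (hF' : ¬ F.Colorable ℓ)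
    (hstab : (complete (Fin (ℓ + 1)) 2).IsEdgeStable (Q.shadow 2) (fun _ => {G | G.IsPartite ℓ}))
    {η : ℝ} (hη : 0 < η) :
    ∃ δ : ℝ, 0 < δ ∧ ∃ N : ℕ, ∀ n, N ≤ n → ∀ H : RGraph (Fin n) r, (expansion F r hr).Free H →
      (1 - δ) * (injMax n Q (expansion F r hr) : ℝ) ≤ Q.inj H →
      ∃ G : RGraph (Fin n) 2, (complete (Fin (ℓ + 1)) 2).Free G ∧
        (1 - η) * (injMax n (Q.shadow 2) (complete (Fin (ℓ + 1)) 2) : ℝ) ≤ (Q.shadow 2).inj G ∧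
        ((H.uncovered G).card : ℝ) ≤ η * (n : ℝ) ^ r := by
  obtain ⟨-, κ, hκ, N₁, hN₁⟩ := isEdgeStable_isPartite_and_exists_le_injMax hℓ hstab
  set m : ℝ := Q.edges.card * r ^ r with hm
  have hm0 : 0 ≤ m := by positivity
  set ε : ℝ := min η (κ * η / (2 * (m + 1))) with hε
  have hε0 : 0 < ε := by positivity
  obtain ⟨N₂, hN₂⟩ := exists_injMax_shadow_le hℓ
    (edges_expansion_nonempty_of_not_colorable (hr := hr) (by omega) hF')
    (fun n c => free_expansion_completePartite hF' c) hstab hε0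
  obtain ⟨N₃, hN₃⟩ := exists_free_complete_card_uncovered_le F hF hr hε0
  refine ⟨min (η / 2) 1, by positivity, N₁ + N₂ + N₃ + 1, fun n hn H hH hQH => ?_⟩
  obtain ⟨G, hG, hGcard⟩ := hN₃ n (by omega) H hH
  refine ⟨G, hG, ?_, hGcard.trans ?_⟩
  · have h1 := hN₁ n (by omega)
    have h2 := hN₂ n (by omega)
    have h3 := inj_le_inj_add Q H (Q.shadow 2) G (H.uncovered G)
      (fun e he => H.uniform e (mem_uncovered.1 he).1)
      (fun φ hφ h => hφ.shadow_of_notMem_uncovered h) (ε := ε)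
      (by rw [Fintype.card_fin]; omega) (by simpa using hGcard)
    rw [← hm, Fintype.card_fin] at h3
    set x : ℝ := (injMax n (Q.shadow 2) (complete (Fin (ℓ + 1)) 2) : ℝ)
    set y : ℝ := (injMax n Q (expansion F r hr) : ℝ)
    set z : ℝ := (n : ℝ) ^ Fintype.card U
    have hz : 0 ≤ z := by positivity
    have hx : 0 ≤ x := Nat.cast_nonneg _
    have hy : 0 ≤ y := Nat.cast_nonneg _
    set δ : ℝ := min (η / 2) 1
    have hδ0 : 0 < δ := by positivity
    have hδ1 : δ ≤ 1 := min_le_right _ _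
    have hδη : δ ≤ η / 2 := min_le_left _ _
    have h4 : (m + 1) * ε ≤ κ * η / 2 := by
      have : ε ≤ κ * η / (2 * (m + 1)) := min_le_right _ _
      rw [le_div_iff₀ (by positivity)] at this
      linarith
    have h5 : (m + 1) * ε * z ≤ κ * η / 2 * z := by gcongr
    have h6 : η / 2 * (κ * z) ≤ η / 2 * x := by gcongr
    have h7 : (1 - δ) * x ≤ (1 - δ) * (y + ε * z) :=
      mul_le_mul_of_nonneg_left h2 (by linarith)
    have h8 : 0 ≤ δ * (ε * z) := by positivity
    have h9 : δ * x ≤ η / 2 * x := by gcongr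
    linarith
  · gcongr
    exact min_le_left _ _

/-- Once `G` is made `ℓ`-partite, every edge of `H` that is still a clique is properly coloured, so
only the uncovered edges need deleting. -/
theorem isEdgeStable_expansion (hℓ : 2 ≤ ℓ) (hr : 2 ≤ r) (Q : RGraph U r)
    {F : SimpleGraph V} (hF : F.Colorable (ℓ + 1)) (hF' : ¬ F.Colorable ℓ)
    (hstab : (complete (Fin (ℓ + 1)) 2).IsEdgeStable (Q.shadow 2) (fun _ => {G | G.IsPartite ℓ})) :
    (expansion F r hr).IsEdgeStable Q (fun _ => {H | H.IsPartite ℓ}) := by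
  intro ε hε
  obtain ⟨δ₁, hδ₁, N₁, hN₁⟩ := hstab (ε / 2) (half_pos hε)
  obtain ⟨δ, hδ, N, hN⟩ := exists_nearly_extremal_shadow hℓ hr Q hF hF' hstab
    (lt_min hδ₁ (half_pos hε))
  refine ⟨δ, hδ, N + N₁ + 1, fun n hn H hH hQH => ?_⟩
  obtain ⟨G, hG, hGinj, hGcard⟩ := hN n (by omega) H hH hQH
  obtain ⟨G', hpart, -, hG'card⟩ := hN₁ n (by omega) G hG (by
    refine le_trans ?_ hGinj
    gcongr
    exact min_le_left _ _)
  obtain ⟨c, hc⟩ := isPartite_iff.1 hpart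
  refine ⟨H.deleteEdges (H.uncovered G'), isPartite_iff.2 ⟨c, fun e he => ?_⟩,
    Finset.sdiff_subset, ?_⟩
  · obtain ⟨he1, he2⟩ := Finset.mem_sdiff.1 he
    exact injOn_of_forall_pair fun p hp hpe => hc p (mem_edges_of_notMem_uncovered he1 he2 hpe hp)
  · have h1 := card_uncovered_le H G G' (ε := ε / 2) (by rw [Fintype.card_fin]; omega)
      (by simpa using hG'card)
    rw [Fintype.card_fin] at h1
    have h2 : (H.edges \ (H.deleteEdges (H.uncovered G')).edges).card ≤ (H.uncovered G').card := by
      refine Finset.card_le_card fun e he => ?_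
      obtain ⟨he1, he2⟩ := Finset.mem_sdiff.1 he
      by_contra h
      exact he2 (Finset.mem_sdiff.2 ⟨he1, h⟩)
    have h3 : min δ₁ (ε / 2) * (n : ℝ) ^ r ≤ ε / 2 * (n : ℝ) ^ r := by
      gcongr
      exact min_le_right _ _
    have h4 : ((H.edges \ (H.deleteEdges (H.uncovered G')).edges).card : ℝ) ≤
        (H.uncovered G').card := Nat.cast_le.2 h2
    linarith

omit [Fintype U] in
theorem isPartite_completePartite {n : ℕ} (c : Fin n → Fin ℓ) :
    (completePartite c r).IsPartite ℓ :=
  isPartite_iff.2 ⟨c, fun _ he => (mem_edges_completePartite.1 he).2⟩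

-- Intersecting `H` with the nearby Turán hypergraph suffices. This makes the edge-stability results
-- available for part (ii).
omit [Fintype U] in
theorem IsTuranStable.isEdgeStable (hℓ : 0 < ℓ) {Q : RGraph U r} {A : RGraph X r}
    (h : Q.IsTuranStable A ℓ) : A.IsEdgeStable Q (fun _ => {H | H.IsPartite ℓ}) := by
  have : NeZero ℓ := ⟨hℓ.ne'⟩
  intro ε hε
  obtain ⟨δ, hδ, N, hN⟩ := h ε hε
  refine ⟨δ, hδ, N, fun n hn H hH hQH => ?_⟩
  obtain ⟨σ, hσ⟩ := hN n hn H hH hQH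
  rw [relabel_turan] at hσ
  set T := completePartite (residue ℓ σ) r
  obtain ⟨c, hc⟩ := isPartite_iff.1 (isPartite_completePartite (r := r) (residue ℓ σ))
  refine ⟨H.deleteEdges (H.edges \ T.edges), isPartite_iff.2 ⟨c, fun e he => hc e ?_⟩,
    Finset.sdiff_subset, le_trans (Nat.cast_le.2 (Finset.card_le_card ?_)) hσ⟩
  · obtain ⟨he1, he2⟩ := Finset.mem_sdiff.1 he
    by_contra h
    exact he2 (Finset.mem_sdiff.2 ⟨he1, h⟩)
  · intro e he
    obtain ⟨he1, he2⟩ := Finset.mem_sdiff.1 he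
    refine Finset.mem_symmDiff.2 (Or.inl ⟨he1, fun h => he2 (Finset.mem_sdiff.2 ⟨he1, ?_⟩)⟩)
    exact fun h' => (Finset.mem_sdiff.1 h').2 h

open Finset in
open scoped Classical in
/-- Every edge of a balanced complete multipartite `r`-graph is the image of a given edge of `Q`
in order `n ^ (q - r)` copies of `Q`. -/
theorem exists_mul_card_le_card_isHom_completePartite [NeZero ℓ] {Q : RGraph U r}
    (hQ : Q.IsPartite ℓ) {E : Finset U} (hE : E ∈ Q.edges) :
    ∃ κ : ℝ, 0 < κ ∧ ∃ N : ℕ, ∀ n, N ≤ n → ∀ (σ : Fin n ≃ Fin n) (R : Finset (Finset (Fin n))),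
      R ⊆ (completePartite (residue ℓ σ) r).edges →
      #R * (κ * (n : ℝ) ^ (Fintype.card U - r)) ≤
        #{φ : U ↪ Fin n | Q.IsHom (completePartite (residue ℓ σ) r) φ ∧ E.map φ ∈ R} := by
  obtain ⟨ψ, hψ⟩ := isPartite_iff.1 hQ
  obtain ⟨κ, hκ, N, hN⟩ := exists_le_card_embedding_residue U ℓ r
  refine ⟨κ, hκ, N + 1, fun n hn σ R hR => ?_⟩
  set T := completePartite (residue ℓ σ) r
  have key : ∀ e ∈ R, κ * (n : ℝ) ^ (Fintype.card U - r) ≤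
      #{φ : U ↪ Fin n | Q.IsHom T φ ∧ E.map φ = e} := by
    intro e he
    obtain ⟨her, hec⟩ := mem_edges_completePartite.1 (hR he)
    have hcard : #E = #e := by rw [Q.uniform E hE, her]
    let ι : E ≃ e := Finset.equivOfCardEq hcard
    let β : U → Fin n := fun u => if h : u ∈ E then ι ⟨u, h⟩ else ⟨0, by omega⟩
    have hβE : ∀ u (h : u ∈ E), β u = ι ⟨u, h⟩ := fun u h => by simp only [β, dif_pos h]
    have hβmem : ∀ u ∈ E, β u ∈ e := fun u h => by
      rw [hβE u h]
      exact (ι _).2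
    have hβ : Set.InjOn β E := fun u hu w hw h => by
      rw [hβE u hu, hβE w hw] at h
      simpa using ι.injective (Subtype.ext h)
    -- The colours on the target edge `e` need not be those that `ψ` gives to `E`. The map `f`
    -- matches them and extends to a permutation `g` of the colours, and `g ∘ ψ` still colours `Q`
    -- properly.
    let f : Fin ℓ → Fin ℓ := fun i =>
      if h : ∃ u ∈ E, ψ u = i then residue ℓ σ (β h.choose) else i
    have hf : ∀ u ∈ E, f (ψ u) = residue ℓ σ (β u) := by
      intro u hu
      have h : ∃ w ∈ E, ψ w = ψ u := ⟨u, hu, rfl⟩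
      simp only [f, dif_pos h]
      rw [hψ E hE h.choose_spec.1 hu h.choose_spec.2]
    obtain ⟨g, hg⟩ := Finset.exists_equiv_extend_of_card_eq (t := (univ : Finset (Fin ℓ)))
      (by simp) (s := E.image ψ) (f := f) (subset_univ _) (by
        rw [coe_image]
        rintro _ ⟨u, hu, rfl⟩ _ ⟨w, hw, rfl⟩ h
        rw [hf u hu, hf w hw] at h
        rw [hβ hu hw (hec (hβmem u hu) (hβmem w hw) h)])
    have h := hN n (by omega) σ (fun u => (g (ψ u) : Fin ℓ)) E β (Q.uniform E hE) hβ fun u hu => by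
      rw [hg _ (mem_image_of_mem _ hu), hf u hu]
    refine h.trans (Nat.cast_le.2 ?_)
    rw [Nat.card_eq_fintype_card, Fintype.card_subtype]
    refine card_le_card fun φ hφ => ?_
    simp only [mem_filter, mem_univ, true_and] at hφ ⊢
    obtain ⟨h1, h2⟩ := hφ
    refine ⟨isHom_completePartite_iff.2 fun E' hE' x hx y hy hxy => ?_, ?_⟩
    · simp only [Function.comp_apply, h1] at hxy
      exact hψ E' hE' hx hy (g.injective (Subtype.ext hxy))
    · refine eq_of_subset_of_card_le (fun x hx => ?_) (by rw [card_map, hcard])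
      obtain ⟨u, hu, rfl⟩ := mem_map.1 hx
      rw [h2 u hu]
      exact hβmem u hu
  have hdisj : (R : Set (Finset (Fin n))).PairwiseDisjoint fun e =>
      ({φ : U ↪ Fin n | Q.IsHom T φ ∧ E.map φ = e} : Finset _) := by
    intro e _ e' _ hne
    simp only [Function.onFun, disjoint_left, mem_filter, mem_univ, true_and]
    rintro φ ⟨-, h1⟩ ⟨-, h2⟩
    exact hne (h1.symm.trans h2)
  calc (#R : ℝ) * (κ * (n : ℝ) ^ (Fintype.card U - r))
      ≤ ∑ e ∈ R, (#{φ : U ↪ Fin n | Q.IsHom T φ ∧ E.map φ = e} : ℝ) := by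
        rw [← nsmul_eq_mul]
        exact card_nsmul_le_sum _ _ _ key
    _ = #(R.biUnion fun e => {φ : U ↪ Fin n | Q.IsHom T φ ∧ E.map φ = e}) := by
        rw [card_biUnion hdisj]
        push_cast
        rfl
    _ ≤ _ := by
        refine Nat.cast_le.2 (card_le_card fun φ hφ => ?_)
        simp only [mem_biUnion, mem_filter, mem_univ, true_and] at hφ ⊢
        obtain ⟨e, he, h1, rfl⟩ := hφ
        exact ⟨h1, he⟩

/-- An `r`-graph whose shadow is Turán-stable has an edge. -/
theorem edges_nonempty_of_isTuranStable_shadow (hℓ : 2 ≤ ℓ) {Q : RGraph U r}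
    (h : (Q.shadow 2).IsTuranStable (complete (Fin (ℓ + 1)) 2) ℓ) : Q.edges.Nonempty := by
  classical
  by_contra hQ
  have : NeZero ℓ := ⟨by omega⟩
  have hK2 : (complete (Fin 2) 2).IsPartite ℓ :=
    isPartite_iff.2 ⟨Fin.castLE hℓ, fun _ _ => (Fin.castLE_injective hℓ).injOn⟩
  obtain ⟨κ, hκ, N, hN⟩ := exists_le_inj_completePartite hK2
  obtain ⟨δ, hδ, N', hN'⟩ := h (κ / 8) (by positivity)
  set n := N + N' + 1 with hn
  -- If `Q` had no edge, the empty graph would also be extremal, although it is at distance of order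
  -- `n ^ 2` from the Turán graph.
  let H : RGraph (Fin n) 2 := ⟨∅, by simp⟩
  have hfree : ∀ m : ℕ, 2 ≤ m → (complete (Fin m) 2).Free H := by
    rintro m hm ⟨φ, hφ⟩
    obtain ⟨e, he⟩ := edges_complete_nonempty hm
    exact absurd (hφ e he) (by simp [H])
  obtain ⟨G, -, hGeq⟩ := (isGreatest_injMax n (Q.shadow 2) (complete (Fin (ℓ + 1)) 2)
    (edges_complete_nonempty (by omega))).1
  have hinj : (Q.shadow 2).inj G ≤ (Q.shadow 2).inj H :=
    Nat.card_mono (Set.toFinite _) fun φ _ p hp => by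
      obtain ⟨-, E, hE, -⟩ := mem_edges_shadow.1 hp
      exact absurd ⟨E, hE⟩ hQ
  obtain ⟨σ, hσ⟩ := hN' n (by omega) H (hfree _ (by omega)) (by
    rw [← hGeq]
    have h1 : ((Q.shadow 2).inj G : ℝ) ≤ (Q.shadow 2).inj H := Nat.cast_le.2 hinj
    have h2 : 0 ≤ δ * ((Q.shadow 2).inj G : ℝ) := by positivity
    linarith)
  rw [relabel_turan] at hσ
  set T := completePartite (residue ℓ σ) 2
  have hT : (T.edges.card : ℝ) ≤ κ / 8 * (n : ℝ) ^ 2 := by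
    refine le_trans (Nat.cast_le.2 (Finset.card_le_card fun e he => ?_)) hσ
    exact Finset.mem_symmDiff.2 (Or.inr ⟨he, by simp [H]⟩)
  have h1 := inj_le_inj_add (complete (Fin 2) 2) T (complete (Fin 2) 2) H T.edges T.uniform
    (fun φ hφ hav => isHom_iff_map.2 fun E hE => absurd (isHom_iff_map.1 hφ E hE) (hav E hE))
    (ε := κ / 8) (by rw [Fintype.card_fin]; omega) (by simpa using hT)
  have h2 := hN n (by omega) σ
  rw [inj_eq_zero (hfree 2 le_rfl)] at h1
  have hcard : (complete (Fin 2) 2).edges.card = 1 := by simp [complete]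
  simp only [hcard, Fintype.card_fin] at h1 h2
  have hpos : (0 : ℝ) < (n : ℝ) ^ 2 := by
    have : (0 : ℝ) < n := by exact_mod_cast (by omega : 0 < n)
    positivity
  norm_num at h1
  have h3 := h2.trans h1
  nlinarith [mul_pos hκ hpos]

theorem inj_le_pow (Q : RGraph U r) (H : RGraph V r) :
    Q.inj H ≤ Fintype.card V ^ Fintype.card U := by
  classical
  calc Q.inj H ≤ Nat.card (U ↪ V) := Finite.card_subtype_le _
    _ ≤ Nat.card (U → V) := Nat.card_le_card_of_injective _ DFunLike.coe_injective
    _ = _ := by simp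

-- Let `T` be the Turán hypergraph on the parts found for `G`. Almost all copies of `Q` in `H` lie
-- in `H ∩ T`, and `T` is itself a competitor for the maximum, so near-extremality of `H` bounds the
-- number of copies of `Q` in `T` that use missing edges.
open Finset in
theorem isTuranStable_expansion (hℓ : 2 ≤ ℓ) (hr : 2 ≤ r) (Q : RGraph U r)
    {F : SimpleGraph V} (hF : F.Colorable (ℓ + 1)) (hF' : ¬ F.Colorable ℓ)
    (hstab : (Q.shadow 2).IsTuranStable (complete (Fin (ℓ + 1)) 2) ℓ) :
    Q.IsTuranStable (expansion F r hr) ℓ := by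
  classical
  have : NeZero ℓ := ⟨by omega⟩
  have hedge := hstab.isEdgeStable (by omega)
  obtain ⟨E, hE⟩ := edges_nonempty_of_isTuranStable_shadow hℓ hstab
  have hQ : Q.IsPartite ℓ := by
    obtain ⟨c, hc⟩ := isPartite_iff.1 (isEdgeStable_isPartite_and_exists_le_injMax hℓ hedge).1
    exact isPartite_iff.2 ⟨c, injOn_edges_shadow_iff.1 hc⟩
  obtain ⟨κ, hκ, N₁, hN₁⟩ := exists_mul_card_le_card_isHom_completePartite hQ hE
  intro ε hε
  set m : ℝ := Q.edges.card * r ^ r with hm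
  have hm0 : 0 ≤ m := by positivity
  set ε₁ : ℝ := min (ε / 4) (κ * ε / (4 * (m + 1))) with hε₁
  have hε₁0 : 0 < ε₁ := by positivity
  have hmε₁ : m * ε₁ ≤ κ * ε / 4 := by
    have : ε₁ ≤ κ * ε / (4 * (m + 1)) := min_le_right _ _
    rw [le_div_iff₀ (by positivity)] at this
    linarith
  obtain ⟨δ₁, hδ₁, N₂, hN₂⟩ := hstab (ε₁ / 2) (half_pos hε₁0)
  obtain ⟨δ₂, hδ₂, N₃, hN₃⟩ := exists_nearly_extremal_shadow hℓ hr Q hF hF' hedge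
    (lt_min hδ₁ (half_pos hε₁0))
  set δ : ℝ := min (min δ₂ (κ * ε / 4)) 1 with hδ
  have hδ0 : 0 < δ := by positivity
  have hδ1 : δ ≤ 1 := min_le_right _ _
  have hδδ₂ : δ ≤ δ₂ := (min_le_left _ _).trans (min_le_left _ _)
  have hδκ : δ ≤ κ * ε / 4 := (min_le_left _ _).trans (min_le_right _ _)
  refine ⟨δ, hδ0, N₁ + N₂ + N₃ + 1, fun n hn H hH hQH => ?_⟩
  have hn0 : 0 < n := by omega
  obtain ⟨G, hG, hGinj, hGcard⟩ := hN₃ n (by omega) H hH (by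
    refine le_trans ?_ hQH
    gcongr)
  obtain ⟨σ, hσ⟩ := hN₂ n (by omega) G hG (by
    refine le_trans ?_ hGinj
    gcongr
    exact min_le_left _ _)
  refine ⟨σ, ?_⟩
  rw [relabel_turan] at hσ ⊢
  set c := residue ℓ σ
  set T := completePartite c r
  have hGT : (#(G.edges \ (completePartite c 2).edges) : ℝ) ≤ ε₁ / 2 * (n : ℝ) ^ 2 := by
    refine le_trans (Nat.cast_le.2 (card_le_card fun e he => ?_)) hσ
    exact mem_symmDiff.2 (Or.inl (mem_sdiff.1 he))
  have hHT : (#(H.edges \ T.edges) : ℝ) ≤ ε₁ * (n : ℝ) ^ r := by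
    have h1 := card_uncovered_le H G (completePartite c 2) (ε := ε₁ / 2)
      (by rw [Fintype.card_fin]; omega) (by simpa using hGT)
    rw [Fintype.card_fin] at h1
    have h2 : (#(H.edges \ T.edges) : ℝ) ≤ #(H.uncovered (completePartite c 2)) := by
      refine Nat.cast_le.2 (card_le_card fun e he => ?_)
      obtain ⟨he1, he2⟩ := mem_sdiff.1 he
      by_contra h
      refine he2 (mem_edges_completePartite.2 ⟨H.uniform e he1, ?_⟩)
      exact injOn_of_forall_pair fun p hp hpe =>
        (mem_edges_completePartite.1 (mem_edges_of_notMem_uncovered he1 h hpe hp)).2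
    have h3 : min δ₁ (ε₁ / 2) * (n : ℝ) ^ r ≤ ε₁ / 2 * (n : ℝ) ^ r := by
      gcongr
      exact min_le_right _ _
    linarith
  have h1 := inj_le_inj_add Q H Q (H.deleteEdges (H.edges \ T.edges)) (H.edges \ T.edges)
    (fun e he => H.uniform e (mem_sdiff.1 he).1)
    (fun φ hφ hav => isHom_iff_map.2 fun E hE =>
      mem_sdiff.2 ⟨isHom_iff_map.1 hφ E hE, hav E hE⟩)
    (ε := ε₁) (by rw [Fintype.card_fin]; omega) (by simpa using hHT)
  rw [← hm, Fintype.card_fin] at h1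
  have h2 := hN₁ n (by omega) σ (T.edges \ H.edges) sdiff_subset
  -- Here `H.deleteEdges (H.edges \ T.edges)` is `H ∩ T`. A copy in it cannot send `E` to an edge
  -- missing from `H`, so the two families are disjoint.
  have h3 : Q.inj (H.deleteEdges (H.edges \ T.edges)) +
      #{φ : U ↪ Fin n | Q.IsHom T φ ∧ E.map φ ∈ T.edges \ H.edges} ≤ Q.inj T := by
    rw [inj_eq_card, inj_eq_card, ← card_union_of_disjoint]
    · refine card_le_card fun φ hφ => ?_
      simp only [mem_union, mem_filter, mem_univ, true_and] at hφ ⊢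
      rcases hφ with hφ | hφ
      · refine isHom_iff_map.2 fun E' hE' => ?_
        obtain ⟨he1, he2⟩ := mem_sdiff.1 (isHom_iff_map.1 hφ E' hE')
        by_contra h
        exact he2 (mem_sdiff.2 ⟨he1, h⟩)
      · exact hφ.1
    · rw [disjoint_left]
      intro φ hφ hφ'
      simp only [mem_filter, mem_univ, true_and] at hφ hφ'
      exact (mem_sdiff.1 hφ'.2).2 (mem_sdiff.1 (isHom_iff_map.1 hφ E hE)).1
  have h4 : (Q.inj T : ℝ) ≤ injMax n Q (expansion F r hr) := by
    exact_mod_cast (isGreatest_injMax n Q (expansion F r hr)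
      (edges_expansion_nonempty_of_not_colorable (by omega) hF')).2
      ⟨_, free_expansion_completePartite hF' c, rfl⟩
  have h5 : (Q.inj T : ℝ) ≤ (n : ℝ) ^ Fintype.card U := by
    have := inj_le_pow Q T
    rw [Fintype.card_fin] at this
    exact_mod_cast this
  have hrU : r ≤ Fintype.card U := by
    rw [← Q.uniform E hE]
    exact card_le_univ E
  have hTH : (#(T.edges \ H.edges) : ℝ) ≤ ε / 2 * (n : ℝ) ^ r := by
    have hpos : (0 : ℝ) < κ * (n : ℝ) ^ (Fintype.card U - r) := by positivity
    refine le_of_mul_le_mul_right ?_ hpos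
    have h6 : ((Q.inj (H.deleteEdges (H.edges \ T.edges)) : ℝ)) +
        (#{φ : U ↪ Fin n | Q.IsHom T φ ∧ E.map φ ∈ T.edges \ H.edges} : ℝ) ≤ Q.inj T := by
      exact_mod_cast h3
    have h7 : (1 - δ) * (Q.inj T : ℝ) ≤ Q.inj H :=
      (mul_le_mul_of_nonneg_left h4 (by linarith)).trans hQH
    have h8 : δ * (Q.inj T : ℝ) ≤ κ * ε / 4 * (n : ℝ) ^ Fintype.card U := by gcongr
    have h9 : m * ε₁ * (n : ℝ) ^ Fintype.card U ≤ κ * ε / 4 * (n : ℝ) ^ Fintype.card U := by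
      gcongr
    have h10 : (n : ℝ) ^ Fintype.card U = (n : ℝ) ^ (Fintype.card U - r) * (n : ℝ) ^ r := by
      rw [← pow_add, Nat.sub_add_cancel hrU]
    -- Each half of `κ * ε / 2` pays for one loss: `δ * Q.inj T` from near-extremality and `m * ε₁ *
    -- n ^ q` from edges of `H` outside `T`.
    have h11 : (#(T.edges \ H.edges) : ℝ) * (κ * (n : ℝ) ^ (Fintype.card U - r)) ≤
        κ * ε / 2 * (n : ℝ) ^ Fintype.card U := by
      refine le_trans (le_of_le_of_eq h2 (by congr!)) ?_
      linarith
    refine h11.trans (le_of_eq ?_)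
    rw [h10]
    ring
  have h6 : (#(symmDiff H.edges T.edges) : ℝ) ≤ #(H.edges \ T.edges) + #(T.edges \ H.edges) := by
    rw [symmDiff_def]
    exact_mod_cast card_union_le _ _
  have h7 : ε₁ * (n : ℝ) ^ r ≤ ε / 4 * (n : ℝ) ^ r := by
    gcongr
    exact min_le_left _ _
  have h8 : 0 ≤ ε * (n : ℝ) ^ r := by positivity
  refine h6.trans ?_
  linarith

end Main

end RGraph

theorem mainTheorem9 {U V : Type*} [Fintype U] [Fintype V] (r ℓ : ℕ) (hr : 2 ≤ r) (hℓ : r ≤ ℓ)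
    (Q : RGraph U r) (F : SimpleGraph V) (hF : F.chromaticNumber = ((ℓ + 1 : ℕ) : ℕ∞)) :
    ((RGraph.complete (Fin (ℓ + 1)) 2).IsEdgeStable (Q.shadow 2)
        (fun _ => {G | G.IsPartite ℓ}) →
      (RGraph.expansion F r hr).IsEdgeStable Q (fun _ => {H | H.IsPartite ℓ})) ∧
    ((Q.shadow 2).IsTuranStable (RGraph.complete (Fin (ℓ + 1)) 2) ℓ →
      Q.IsTuranStable (RGraph.expansion F r hr) ℓ) := by
  -- The upper bound on the chromatic number feeds the removal lemma; the lower bound makes complete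
  -- `ℓ`-partite `r`-graphs admissible competitors.
  have h1 : F.Colorable (ℓ + 1) := SimpleGraph.chromaticNumber_le_iff_colorable.1 hF.le
  have h2 : ¬ F.Colorable ℓ := fun h => by
    have := SimpleGraph.chromaticNumber_le_iff_colorable.2 h
    rw [hF, Nat.cast_le] at this
    omega
  exact ⟨RGraph.isEdgeStable_expansion (hr.trans hℓ) hr Q h1 h2,
    RGraph.isTuranStable_expansion (hr.trans hℓ) hr Q h1 h2⟩
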